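/- **Setting.** Let $X\neq\{0\}$ be a real Banach space. An *invertible evolution process* on $X$ is a family $\mathcal S=\{S(t,s):t,s\in\mathbb R\}\subset\mathcal L(X)$ with $S(t,t)=\mathrm{Id}$, $S(t,s)S(s,\tau)=S(t,\tau)$ for $t\ge s\ge\tau$, $(t,s,x)\mapsto S(t,s)x$ continuous on $\{t\ge s\}\times X$, and $S(s,t)=S(t,s)^{-1}$ for $t\ge s$. A family $\{S(t,s):t,s\in\mathbb R\}$ of bounded operators admits a *nonuniform exponential dichotomy of type I* (NEDI) with bound $Ke^{\mu|t|}$ and exponent $\lambda$ if there are bounded projections $\Pi^u(t)$, $t\in\mathbb R$, with $\Pi^s(t)=\mathrm{Id}-\Pi^u(t)$, such that for $t\ge s$: $\Pi^u(t)S(t,s)=S(t,s)\Pi^u(s)$, and $S(t,s)$ maps the range of $\Pi^u(s)$ isomorphically onto the range of $\Pi^u(t)$, with inverse $S(s,t)$ there; and there are $K,\alpha,\beta>0$, $\delta,\nu\ge0$ with $\max\{\delta,\nu\}=\mu$, $\min\{\alpha,\beta\}=\lambda$ and $$\|S(t,s)\Pi^s(s)\|\le Ke^{\delta|s|}e^{-\alpha(t-s)}\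 (t\ge s),\qquad \|S(t,s)\Pi^u(s)\|\le Ke^{\nu|s|}e^{\beta(t-s)}\ (t<s).$$ It admits a *nonuniform exponential dichotomy of type II* (NEDII) if the same holds with $|s|$ replaced by $|t|$ in the two estimates. For $\omega,\varepsilon>0$ and $L\geq 0$ put $$\tilde\omega=-\ln\!\big(\cosh\omega-[\cosh^2\omega-1-2\varepsilon\sinh\omega]^{1/2}\big),\quad \tilde\beta=\tilde\omega+\ln(1+2\varepsilon\sinh\omega),\quad \rho=\frac{\varepsilon(1+e^{-\omega})}{1-e^{-\omega}},$$ $$M_1=\Big[1-\frac{\varepsilon e^{-\omega}}{1-e^{-\omega-\tilde\omega}}\Big]^{-1},\quad M_2=\Big[1-\frac{\varepsilon e^{-\tilde\beta}}{1-e^{-\omega-\tilde\beta}}\Big]^{-1},$$ $$\widehat M=M\Big(1+\frac{\varepsilon}{(1-\rho)(1-e^{-\omega})}\Big)\max\{M_1,M_2\},\qquad K(\varepsilon,L)=\widehat M^2e^{2\tilde\omega}\max\{L,L^2\}.$$ **Theorem (Robustness of NEDII).** Let $\mathcal S_1$ be an invertible evolution process on $X$ that admits a NEDII with bound $Me^{\upsilon|t|}$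 and exponent $\omega$, where $0<\upsilon<\omega$, and suppose that $$\sup_{0\le t-s\le1}e^{-\upsilon|t|}\|S_1(t,s)\|<\infty .$$ Then there is $\varepsilon_0>0$ such that for every $\varepsilon\in(0,\varepsilon_0]$ all the constants above are well defined (the radicand, the arguments of the logarithms and all denominators are positive, and $\rho<1$), $\hat\omega:=\tilde\omega-\upsilon>0$, and the following holds for every invertible evolution process $\mathcal S_2$ on $X$ with $$\sup_{0\le t-s\le1}e^{\upsilon|s|}\|S_1(t,s)-S_2(t,s)\|<\varepsilon .$$ Let $T_2(t,s)=[S_2(s,t)]^*$ on $X^*$ for $t,s\in\mathbb R$, and put $$L_{\mathcal S_2}=\sup_{0\le t-s\le1}e^{-\upsilon|t|}\|S_2(t,s)\|,\qquad L_{\mathcal T_2}=\sup_{0\le t-s\le1}e^{-\upsilon|t|}\|T_2(t,s)\|.$$ 1. $T_2(t,t)=\mathrm{Id}$ and $T_2(t,s)T_2(s,\tau)=T_2(t,\tau)$ for all $t,s,\tau\in\mathbb R$; for every $x\in X$ the map $(t,s,x^*)\mapsto\langle x,T_2(t,s)x^*\rangle$ is continuous on $\mathbb R^2\times X^*$; and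 $L_{\mathcal S_2}<\infty$. 2. $\mathcal T_2$ admits a NEDI with exponent $\hat\omega$ and bound $K(\varepsilon,L)\,e^{2\upsilon|t|}$, both for $L=L_{\mathcal S_2}$ and, whenever $L_{\mathcal T_2}<\infty$, for $L=L_{\mathcal T_2}$. 3. If $X$ is reflexive, then $\mathcal S_2$ itself admits a NEDII with the same bounds and exponent as in 2. -/

import Mathlib

/-- A family `S(t,s)`, `t, s ∈ ℝ`, of bounded linear operators is an invertible (linear) evolution
process: `S(t,s)`, `t ≥ s`, is an evolution process, and `S(s,t)` is the inverse of `S(t,s)`. -/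
structure IsInvertibleEvolutionProcess {X : Type*} [NormedAddCommGroup X] [NormedSpace ℝ X]
    (S : ℝ → ℝ → X →L[ℝ] X) : Prop where
  refl : ∀ t, S t t = ContinuousLinearMap.id ℝ X
  comp : ∀ t s τ, τ ≤ s → s ≤ t → (S t s).comp (S s τ) = S t τ
  cont : ContinuousOn (fun p : ℝ × ℝ × X => S p.1 p.2.1 p.2.2) {p | p.2.1 ≤ p.1}
  left_inv : ∀ t s, s ≤ t → (S s t).comp (S t s) = ContinuousLinearMap.id ℝ X
  right_inv : ∀ t s, s ≤ t → (S t s).comp (S s t) = ContinuousLinearMap.id ℝ X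

/-- The algebraic part of a nonuniform exponential dichotomy on `ℝ` (of either type) with unstable
projections `P t = Π^u(t)`: each `P t` is a bounded projection, the projections are invariant, and
`S(t,s)`, `t ≥ s`, is an isomorphism of the range of `Π^u(s)` onto the range of `Π^u(t)` whose
inverse is given there by `S(s,t)`. -/
structure IsInvariantSplitting {X : Type*} [NormedAddCommGroup X] [NormedSpace ℝ X]
    (S : ℝ → ℝ → X →L[ℝ] X) (P : ℝ → X →L[ℝ] X) : Prop where
  proj : ∀ t, (P t).comp (P t) = P t
  comm : ∀ t s, s ≤ t → (P t).comp (S t s) = (S t s).comp (P s)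
  bijOn : ∀ t s, s ≤ t → Set.BijOn (S t s) (Set.range (P s)) (Set.range (P t))
  invOn : ∀ t s, s ≤ t → Set.InvOn (S s t) (S t s) (Set.range (P s)) (Set.range (P t))

/-- `S` admits a nonuniform exponential dichotomy of type I on `ℝ` with bound
`t ↦ M e^{υ|t|}` and exponent `ω`. -/
def AdmitsNEDI {X : Type*} [NormedAddCommGroup X] [NormedSpace ℝ X]
    (S : ℝ → ℝ → X →L[ℝ] X) (M υ ω : ℝ) : Prop :=
  ∃ P : ℝ → X →L[ℝ] X, IsInvariantSplitting S P ∧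
    ∃ α β δ ν : ℝ, 0 < M ∧ 0 < α ∧ 0 < β ∧ 0 ≤ δ ∧ 0 ≤ ν ∧ max δ ν = υ ∧ min α β = ω ∧
      (∀ t s, s ≤ t → ‖(S t s).comp (ContinuousLinearMap.id ℝ X - P s)‖ ≤
        M * Real.exp (δ * |s|) * Real.exp (-α * (t - s))) ∧
      (∀ t s, t < s → ‖(S t s).comp (P s)‖ ≤
        M * Real.exp (ν * |s|) * Real.exp (β * (t - s)))

/-- `S` admits a nonuniform exponential dichotomy of type II on `ℝ` with bound
`t ↦ M e^{υ|t|}` and exponent `ω`: the bound is taken at the final time. -/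
def AdmitsNEDII {X : Type*} [NormedAddCommGroup X] [NormedSpace ℝ X]
    (S : ℝ → ℝ → X →L[ℝ] X) (M υ ω : ℝ) : Prop :=
  ∃ P : ℝ → X →L[ℝ] X, IsInvariantSplitting S P ∧
    ∃ α β δ ν : ℝ, 0 < M ∧ 0 < α ∧ 0 < β ∧ 0 ≤ δ ∧ 0 ≤ ν ∧ max δ ν = υ ∧ min α β = ω ∧
      (∀ t s, s ≤ t → ‖(S t s).comp (ContinuousLinearMap.id ℝ X - P s)‖ ≤
        M * Real.exp (δ * |t|) * Real.exp (-α * (t - s))) ∧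
      (∀ t s, t < s → ‖(S t s).comp (P s)‖ ≤
        M * Real.exp (ν * |t|) * Real.exp (β * (t - s)))

/-- The dual family `T(t,s) = [S(s,t)]^*` on the dual space `X^*`. -/
noncomputable def dualFamily {X : Type*} [NormedAddCommGroup X] [NormedSpace ℝ X]
    (S : ℝ → ℝ → X →L[ℝ] X) : ℝ → ℝ → StrongDual ℝ X →L[ℝ] StrongDual ℝ X :=
  fun t s => ContinuousLinearMap.precomp ℝ (S s t)

/-- A family of bounded operators on `X^*` indexed by `ℝ²` is an invertible evolution process with
respect to the weak-star topology: the identities of a process hold for all times (so that `T(s,t)`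
is the inverse of `T(t,s)`), and `(t,s,φ) ↦ (T(t,s) φ)(x)` is continuous for every `x`. -/
structure IsWeakStarInvertibleProcess {X : Type*} [NormedAddCommGroup X] [NormedSpace ℝ X]
    (T : ℝ → ℝ → StrongDual ℝ X →L[ℝ] StrongDual ℝ X) : Prop where
  refl : ∀ t, T t t = ContinuousLinearMap.id ℝ (StrongDual ℝ X)
  comp : ∀ t s τ, (T t s).comp (T s τ) = T t τ
  cont : ∀ x : X, Continuous (fun p : ℝ × ℝ × StrongDual ℝ X => T p.1 p.2.1 p.2.2 x)

/-- The numbers `e^{-υ|t|} ‖S(t,s)‖`, `0 ≤ t - s ≤ 1`. -/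
def growthSet {X : Type*} [NormedAddCommGroup X] [NormedSpace ℝ X]
    (υ : ℝ) (S : ℝ → ℝ → X →L[ℝ] X) : Set ℝ :=
  {r | ∃ t s : ℝ, 0 ≤ t - s ∧ t - s ≤ 1 ∧ r = Real.exp (-υ * |t|) * ‖S t s‖}

/-- The numbers `e^{υ|s|} ‖S₁(t,s) - S₂(t,s)‖`, `0 ≤ t - s ≤ 1`. -/
def gapSet {X : Type*} [NormedAddCommGroup X] [NormedSpace ℝ X]
    (υ : ℝ) (S₁ S₂ : ℝ → ℝ → X →L[ℝ] X) : Set ℝ :=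
  {r | ∃ t s : ℝ, 0 ≤ t - s ∧ t - s ≤ 1 ∧ r = Real.exp (υ * |s|) * ‖S₁ t s - S₂ t s‖}

/-! Constants of the perturbed dichotomy. -/

/-- `ω̃ = -ln (cosh ω - (cosh² ω - 1 - 2 ε sinh ω)^{1/2})`. -/
noncomputable def omegaTilde (ω ε : ℝ) : ℝ :=
  -Real.log (Real.cosh ω - Real.sqrt (Real.cosh ω ^ 2 - 1 - 2 * ε * Real.sinh ω))

/-- `β̃ = ω̃ + ln (1 + 2 ε sinh ω)`. -/
noncomputable def betaTilde (ω ε : ℝ) : ℝ :=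
  omegaTilde ω ε + Real.log (1 + 2 * ε * Real.sinh ω)

/-- `ρ = ε (1 + e^{-ω}) / (1 - e^{-ω})`. -/
noncomputable def rhoConst (ω ε : ℝ) : ℝ :=
  ε * (1 + Real.exp (-ω)) / (1 - Real.exp (-ω))

/-- `M₁ = [1 - ε e^{-ω} / (1 - e^{-ω-ω̃})]⁻¹`. -/
noncomputable def mOne (ω ε : ℝ) : ℝ :=
  (1 - ε * Real.exp (-ω) / (1 - Real.exp (-ω - omegaTilde ω ε)))⁻¹

/-- `M₂ = [1 - ε e^{-β̃} / (1 - e^{-ω-β̃})]⁻¹`. -/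
noncomputable def mTwo (ω ε : ℝ) : ℝ :=
  (1 - ε * Real.exp (-betaTilde ω ε) / (1 - Real.exp (-ω - betaTilde ω ε)))⁻¹

/-- `M̂ = M (1 + ε / ((1 - ρ)(1 - e^{-ω}))) max {M₁, M₂}`. -/
noncomputable def mHat (M ω ε : ℝ) : ℝ :=
  M * (1 + ε / ((1 - rhoConst ω ε) * (1 - Real.exp (-ω)))) * max (mOne ω ε) (mTwo ω ε)

/-- `M̂² e^{2ω̃} max {L, L²}`, the constant of the bound of the perturbed dichotomy. -/
noncomputable def boundConst (M ω ε L : ℝ) : ℝ :=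
  mHat M ω ε ^ 2 * Real.exp (2 * omegaTilde ω ε) * max L (L ^ 2)

/-- `ε` is so small that the constants above are well defined (the radicand, the arguments of the
logarithms and all denominators are positive). -/
structure ConstantsWellDefined (ω ε : ℝ) : Prop where
  radicand : 0 < Real.cosh ω ^ 2 - 1 - 2 * ε * Real.sinh ω
  log_arg : 0 < Real.cosh ω - Real.sqrt (Real.cosh ω ^ 2 - 1 - 2 * ε * Real.sinh ω)
  log_arg' : 0 < 1 + 2 * ε * Real.sinh ω
  rho : rhoConst ω ε < 1
  denom_one : 0 < 1 - Real.exp (-ω - omegaTilde ω ε)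
  denom_two : 0 < 1 - Real.exp (-ω - betaTilde ω ε)
  mOne_denom : 0 < 1 - ε * Real.exp (-ω) / (1 - Real.exp (-ω - omegaTilde ω ε))
  mTwo_denom : 0 < 1 - ε * Real.exp (-betaTilde ω ε) / (1 - Real.exp (-ω - betaTilde ω ε))

/-! The dichotomy is built for `S₂` itself, through its Green's operator, and then dualized. On the
grid s + ℤ, a discrete variation of constants formula expresses z(t) = G₂(t,s) as G₁(t,s), plus the
sum over k of G₁(t,s+k+1)(S₂ - S₁)(s+k+1,s+k) z(s+k), plus a correction from the last grid point to
t (`perturbationMap`). In type II the nonuniformity sits at the final time. So the growth e^{υ|r|}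
of z at an intermediate time r is cancelled by the factor e^{-υ|r|} of the gap, and the outcome is
again of size e^{υ|t|}. Giving up υ of the exponent ω makes the series converge, and for small ε the
map contracts in `greenWeight` (`exists_fixedPoint`). A fixed point follows `S₂` except for a jump
by the identity at s (`fixedPoint_of_le`, `fixedPoint_of_lt`), so z(s) is the candidate for the
stable projection.

That the candidates are invariant projections is a matter of uniqueness: `S₂` has no nonzero
solution on ℝ bounded by C e^{υ|t|}, because comparison with `S₁` improves C by a factor below 1
(`solution_eq_zero`). Hence `exists_splitting`, with exponent ω - υ and constant M/(1 - εD), D =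
`contractionConst`.

The constants of the theorem are weaker: ω̃ ≤ ω and, for small ε, M/(1 - εD) ≤ M e^{2ω̃} ≤ K(ε,L),
since M and L are at least 1. Finally, T₂(t,s) = [S₂(s,t)]^* exchanges initial and final times, and
stable and unstable parts, which turns type II into type I. -/

open Filter Topology

/-! ### Invertible processes, invariant splittings and Green's operator. -/

section EvolutionProcess

variable {X : Type*} [NormedAddCommGroup X] [NormedSpace ℝ X] {S : ℝ → ℝ → X →L[ℝ] X}

namespace IsInvertibleEvolutionProcess

theorem apply_inv (h : IsInvertibleEvolutionProcess S) (t s : ℝ) (x : X) :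
    S s t (S t s x) = x := by
  rcases le_total s t with hst | hst
  · exact DFunLike.congr_fun (h.left_inv t s hst) x
  · exact DFunLike.congr_fun (h.right_inv s t hst) x

theorem apply_forward (h : IsInvertibleEvolutionProcess S) {t s τ : ℝ} (h₁ : τ ≤ s) (h₂ : s ≤ t)
    (x : X) : S t s (S s τ x) = S t τ x :=
  DFunLike.congr_fun (h.comp t s τ h₁ h₂) x

theorem apply_of_le_le (h : IsInvertibleEvolutionProcess S) {a t s : ℝ} (hat : a ≤ t)
    (has : a ≤ s) (x : X) : S t a (S a s x) = S t s x := by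
  rcases le_total s t with hst | hst
  · rw [← h.apply_forward has hst, h.apply_inv]
  · have key : ∀ y, S t s (S s a y) = S t a y := fun y => by
      rw [← h.apply_forward hat hst, h.apply_inv]
    rw [← key, h.apply_inv]

/-- The cocycle identity holds without any ordering of the times. -/
theorem apply_apply (h : IsInvertibleEvolutionProcess S) (t s τ : ℝ) (x : X) :
    S t s (S s τ x) = S t τ x := by
  -- Each operator factors through a time before all three, and the inner factors cancel.
  obtain ⟨a, hat, has, haτ⟩ : ∃ a, a ≤ t ∧ a ≤ s ∧ a ≤ τ :=
    ⟨min t (min s τ), by simp, by simp, by simp⟩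
  rw [← h.apply_of_le_le hat has, ← h.apply_of_le_le has haτ, h.apply_inv,
    h.apply_of_le_le hat haτ]

theorem refl_apply (h : IsInvertibleEvolutionProcess S) (t : ℝ) (x : X) : S t t x = x := by
  simp [h.refl t]

theorem comp_comp (h : IsInvertibleEvolutionProcess S) (t s τ : ℝ) :
    (S t s).comp (S s τ) = S t τ := by
  ext x; exact h.apply_apply t s τ x

/-- An invertible process is strongly continuous in both times without any ordering. -/
theorem continuous_apply (h : IsInvertibleEvolutionProcess S) (x : X) :
    Continuous (fun p : ℝ × ℝ => S p.1 p.2 x) := by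
  rw [continuous_iff_continuousAt]
  rintro ⟨s₀, t₀⟩
  -- Near the given point S(p.1,p.2) = S(p.1,a) S(a,b) S(b,p.2): the outer factors run forward in
  -- time and the middle one is a fixed bounded operator.
  obtain ⟨a, has, hat⟩ : ∃ a, a < s₀ ∧ a < t₀ :=
    ⟨min s₀ t₀ - 1, by linarith [min_le_left s₀ t₀], by linarith [min_le_right s₀ t₀]⟩
  obtain ⟨b, hb⟩ : ∃ b, t₀ < b := ⟨t₀ + 1, by linarith⟩
  have hU : {p : ℝ × ℝ | a < p.1 ∧ p.2 < b} ∈ 𝓝 (s₀, t₀) :=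
    ((isOpen_lt continuous_const continuous_fst).inter
      (isOpen_lt continuous_snd continuous_const)).mem_nhds ⟨has, hb⟩
  refine ContinuousOn.continuousAt (s := {p : ℝ × ℝ | a < p.1 ∧ p.2 < b}) ?_ hU
  have h1 : ContinuousOn (fun p : ℝ × ℝ => S b p.2 x) {p : ℝ × ℝ | a < p.1 ∧ p.2 < b} :=
    h.cont.comp (f := fun p : ℝ × ℝ => (b, p.2, x)) (by fun_prop) (fun p hp => hp.2.le)
  have h2 : ContinuousOn (fun p : ℝ × ℝ => S p.1 a (S a b (S b p.2 x)))
      {p : ℝ × ℝ | a < p.1 ∧ p.2 < b} :=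
    h.cont.comp (f := fun p : ℝ × ℝ => (p.1, a, S a b (S b p.2 x)))
      (continuousOn_fst.prodMk (continuousOn_const.prodMk
        ((S a b).continuous.comp_continuousOn h1))) (fun p hp => hp.1.le)
  exact h2.congr fun p _ => by simp only [h.apply_apply]

theorem dual_isWeakStarInvertibleProcess (h : IsInvertibleEvolutionProcess S) :
    IsWeakStarInvertibleProcess (dualFamily S) where
  refl t := by
    ext φ x; simp [dualFamily, h.refl_apply]
  comp t s τ := by
    ext φ x; simp [dualFamily, h.apply_apply]
  cont x := by
    have hc := (h.continuous_apply x).comp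
      (f := fun p : ℝ × ℝ × StrongDual ℝ X => (p.2.1, p.1)) (by fun_prop)
    exact Continuous.clm_apply (f := fun p : ℝ × ℝ × StrongDual ℝ X => p.2.2) (by fun_prop) hc

end IsInvertibleEvolutionProcess

theorem IsInvariantSplitting.comm_apply {P : ℝ → X →L[ℝ] X} (hP : IsInvariantSplitting S P)
    (h : IsInvertibleEvolutionProcess S) (t s : ℝ) (x : X) : P t (S t s x) = S t s (P s x) := by
  rcases le_total s t with hst | hst
  · exact DFunLike.congr_fun (hP.comm t s hst) x
  · have key : P s (S s t (S t s x)) = S s t (P t (S t s x)) :=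
      DFunLike.congr_fun (hP.comm s t hst) (S t s x)
    rw [h.apply_inv] at key
    rw [key, h.apply_inv]

/-- For an invertible process, invariant projections form an invariant splitting. -/
theorem IsInvariantSplitting.of_comm {P : ℝ → X →L[ℝ] X} (hid : ∀ t x, S t t x = x)
    (hcomp : ∀ t s τ x, S t s (S s τ x) = S t τ x)
    (hproj : ∀ t x, P t (P t x) = P t x)
    (hcomm : ∀ t s x, P t (S t s x) = S t s (P s x)) : IsInvariantSplitting S P where
  proj t := by ext x; exact hproj t x
  comm t s _ := by ext x; exact hcomm t s x
  bijOn t s _ := by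
    refine ⟨?_, ?_, ?_⟩
    · rintro _ ⟨x, rfl⟩; exact ⟨S t s x, hcomm t s x⟩
    · intro x _ y _ hxy
      have := congrArg (S s t) hxy
      simpa [hcomp, hid] using this
    · rintro _ ⟨x, rfl⟩
      exact ⟨P s (S s t x), ⟨_, rfl⟩, by rw [← hcomm, hcomp, hid]⟩
  invOn t s _ := ⟨fun x _ => by rw [hcomp, hid], fun x _ => by rw [hcomp, hid]⟩

/-- Green's operator of a splitting with unstable projections `P`. -/
noncomputable def greenOp (S : ℝ → ℝ → X →L[ℝ] X) (P : ℝ → X →L[ℝ] X) (t s : ℝ) : X →L[ℝ] X :=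
  if s ≤ t then (S t s).comp (ContinuousLinearMap.id ℝ X - P s) else -((S t s).comp (P s))

theorem greenOp_of_le {P : ℝ → X →L[ℝ] X} {t s : ℝ} (h : s ≤ t) :
    greenOp S P t s = (S t s).comp (ContinuousLinearMap.id ℝ X - P s) := if_pos h

theorem greenOp_of_lt {P : ℝ → X →L[ℝ] X} {t s : ℝ} (h : t < s) :
    greenOp S P t s = -((S t s).comp (P s)) := if_neg (not_le.2 h)

/-- Propagating Green's operator does not cross the diagonal, except through the identity. -/
theorem IsInvertibleEvolutionProcess.comp_greenOp (h : IsInvertibleEvolutionProcess S)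
    {P : ℝ → X →L[ℝ] X} {t r s : ℝ} (hrt : r ≤ t) :
    (S t r).comp (greenOp S P r s) =
      greenOp S P t s - if r < s ∧ s ≤ t then S t s else 0 := by
  ext x
  by_cases h1 : s ≤ r
  · have : ¬ (r < s ∧ s ≤ t) := fun hh => absurd hh.1 (not_lt.2 h1)
    simp [greenOp_of_le h1, greenOp_of_le (h1.trans hrt), this, h.apply_apply]
  · rw [not_le] at h1
    -- With r < s ≤ t the unstable branch -S(t,s)P is carried into the region of the stable branch
    -- S(t,s)(Id - P); the two differ by S(t,s).
    by_cases h2 : s ≤ t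
    · simp [greenOp_of_lt h1, greenOp_of_le h2, h1, h2, h.apply_apply]
    · simp [greenOp_of_lt h1, greenOp_of_lt (not_le.1 h2), h2, h.apply_apply]

end EvolutionProcess

/-! ### Exponential sums over ℤ and a weighted contraction principle. -/

section Analysis

theorem summable_exp_neg_mul_abs_int {κ : ℝ} (hκ : 0 < κ) :
    Summable (fun k : ℤ => Real.exp (-κ * |(k : ℝ)|)) := by
  have h0 : Summable (fun n : ℕ => Real.exp (-κ * n)) := by
    have := Real.summable_exp_nat_mul_iff (a := -κ) |>.2 (by linarith)
    simpa [mul_comm] using this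
  refine Summable.of_nat_of_neg ?_ ?_ <;> simpa using h0

/-- Replacing x by its floor costs at most 1 in the distance, hence the factor e^κ. As k ↦ ⌊x⌋ - k
permutes ℤ, the sums over k are then bounded uniformly in x. -/
theorem exp_neg_mul_abs_sub_le {κ : ℝ} (hκ : 0 < κ) (x : ℝ) (k : ℤ) :
    Real.exp (-κ * |x - k|) ≤
      Real.exp κ * Real.exp (-κ * |((Equiv.subLeft ⌊x⌋ k : ℤ) : ℝ)|) := by
  rw [← Real.exp_add, Real.exp_le_exp]
  have h1 : |((⌊x⌋ - k : ℤ) : ℝ)| ≤ |x - k| + 1 := by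
    have h2 : ((⌊x⌋ - k : ℤ) : ℝ) = (x - k) - Int.fract x := by
      push_cast; rw [← Int.self_sub_floor]; ring
    rw [h2]
    refine (abs_sub _ _).trans ?_
    rw [abs_of_nonneg (Int.fract_nonneg x)]
    linarith [Int.fract_lt_one x]
  simp only [Equiv.subLeft_apply]
  nlinarith

theorem summable_exp_neg_mul_abs_sub {κ : ℝ} (hκ : 0 < κ) (x : ℝ) :
    Summable (fun k : ℤ => Real.exp (-κ * |x - k|)) :=
  Summable.of_nonneg_of_le (fun _ => (Real.exp_pos _).le) (exp_neg_mul_abs_sub_le hκ x)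
    (((Equiv.subLeft ⌊x⌋).summable_iff.2 (summable_exp_neg_mul_abs_int hκ)).mul_left _)

theorem tsum_exp_neg_mul_abs_sub_le {κ : ℝ} (hκ : 0 < κ) (x : ℝ) :
    ∑' k : ℤ, Real.exp (-κ * |x - k|) ≤
      Real.exp κ * ∑' k : ℤ, Real.exp (-κ * |(k : ℝ)|) := by
  have h := (Equiv.subLeft ⌊x⌋).summable_iff.2 (summable_exp_neg_mul_abs_int hκ)
  refine (Summable.tsum_le_tsum (exp_neg_mul_abs_sub_le hκ x)
    (summable_exp_neg_mul_abs_sub hκ x) (h.mul_left _)).trans ?_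
  rw [tsum_mul_left]
  exact le_of_eq (congrArg _
    ((Equiv.subLeft ⌊x⌋).tsum_eq (fun k : ℤ => Real.exp (-κ * |(k : ℝ)|))))

/-- The contraction principle in a weighted supremum norm. -/
theorem exists_fixedPoint_of_weighted_contraction {ι E : Type*} [NormedAddCommGroup E]
    [CompleteSpace E] (w : ι → ℝ) (F : (ι → E) → ι → E) {C₀ ρ : ℝ} (hC₀ : 0 ≤ C₀) (hρ : 0 ≤ ρ)
    (hρ1 : ρ < 1) (h0 : ∀ t, ‖F 0 t‖ ≤ C₀ * w t)
    (hF : ∀ z z' : ι → E, (∃ C, ∀ t, ‖z t‖ ≤ C * w t) → (∃ C, ∀ t, ‖z' t‖ ≤ C * w t) →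
      ∀ C, 0 ≤ C → (∀ t, ‖z t - z' t‖ ≤ C * w t) → ∀ t, ‖F z t - F z' t‖ ≤ ρ * C * w t) :
    ∃ z : ι → E, (∀ t, ‖z t‖ ≤ C₀ / (1 - ρ) * w t) ∧ F z = z := by
  set u : ℕ → ι → E := fun n => F^[n] 0 with hu
  have hsucc : ∀ n, u (n + 1) = F (u n) := fun n => Function.iterate_succ_apply' F n 0
  -- The contraction estimate applies only to functions of finite weighted norm, so the induction
  -- carries such a bound along with the geometric step.
  have hstep : ∀ n, (∃ C, ∀ t, ‖u n t‖ ≤ C * w t) ∧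
      ∀ t, ‖u (n + 1) t - u n t‖ ≤ ρ ^ n * C₀ * w t := by
    intro n
    induction n with
    | zero =>
      refine ⟨⟨0, fun t => by simp [hu]⟩, fun t => ?_⟩
      have : u 1 t - u 0 t = F 0 t := by simp [hu]
      simpa [this] using h0 t
    | succ n ih =>
      obtain ⟨⟨C, hC⟩, hd⟩ := ih
      have hb : ∃ C, ∀ t, ‖u (n + 1) t‖ ≤ C * w t := by
        refine ⟨ρ ^ n * C₀ + C, fun t => ?_⟩
        have := norm_add_le (u (n + 1) t - u n t) (u n t)
        rw [sub_add_cancel] at this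
        linarith [hC t, hd t, add_mul (ρ ^ n * C₀) C (w t)]
      refine ⟨hb, fun t => ?_⟩
      rw [hsucc (n + 1)]
      conv_lhs => rw [hsucc n]
      have := hF (u (n + 1)) (u n) hb ⟨C, hC⟩ _ (by positivity) hd t
      rw [hsucc n] at this
      rw [pow_succ']
      linarith [mul_assoc (ρ) (ρ ^ n) C₀]
  have hdist : ∀ t n, dist (u n t) (u (n + 1) t) ≤ C₀ * w t * ρ ^ n := fun t n => by
    rw [dist_comm, dist_eq_norm]; linarith [(hstep n).2 t, mul_comm (C₀ * w t) (ρ ^ n),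
      mul_assoc (ρ ^ n) C₀ (w t)]
  have hlim : ∀ t, ∃ a, Tendsto (fun n => u n t) atTop (𝓝 a) := fun t =>
    cauchySeq_tendsto_of_complete (cauchySeq_of_le_geometric ρ _ hρ1 (hdist t))
  choose z hz using hlim
  have hzn : ∀ n t, ‖z t - u n t‖ ≤ ρ ^ n * (C₀ / (1 - ρ)) * w t := fun n t => by
    have := dist_le_of_le_geometric_of_tendsto ρ _ hρ1 (hdist t) (hz t) n
    rw [dist_comm, dist_eq_norm] at this
    refine this.trans (le_of_eq ?_)
    ring
  have hzb : ∀ t, ‖z t‖ ≤ C₀ / (1 - ρ) * w t := fun t => by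
    have := hzn 0 t; simpa [hu] using this
  have h1ρ : 0 < 1 - ρ := by linarith
  refine ⟨z, hzb, funext fun t => ?_⟩
  have hFz : Tendsto (fun n => u (n + 1) t) atTop (𝓝 (F z t)) := by
    rw [tendsto_iff_norm_sub_tendsto_zero]
    have hρn : Tendsto (fun n : ℕ => ρ * (ρ ^ n * (C₀ / (1 - ρ))) * w t) atTop (𝓝 0) := by
      have := ((tendsto_pow_atTop_nhds_zero_of_lt_one hρ hρ1).const_mul ρ).mul_const
        (C₀ / (1 - ρ) * w t)
      simpa [mul_assoc] using this
    refine squeeze_zero (fun _ => norm_nonneg _) (fun n => ?_) hρn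
    rw [norm_sub_rev, hsucc]
    exact hF z (u n) ⟨_, hzb⟩ (hstep n).1 _ (by positivity) (hzn n) t
  exact tendsto_nhds_unique hFz ((tendsto_add_atTop_iff_nat 1).2 (hz t))

end Analysis

/-! ### Uniqueness: bounded solutions of the perturbed process vanish. -/

section Robustness

variable {X : Type*} [NormedAddCommGroup X] [NormedSpace ℝ X]

/-- `S₂` is a perturbation of the process `S₁`, which has a splitting whose Green's operator
satisfies a dichotomy estimate with the nonuniformity at the final time. -/
structure IsPerturbedDichotomy (S₁ S₂ : ℝ → ℝ → X →L[ℝ] X) (P : ℝ → X →L[ℝ] X)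
    (M υ ω ε : ℝ) : Prop where
  process₁ : IsInvertibleEvolutionProcess S₁
  process₂ : IsInvertibleEvolutionProcess S₂
  splitting : IsInvariantSplitting S₁ P
  υ_pos : 0 < υ
  υ_lt : υ < ω
  M_nonneg : 0 ≤ M
  ε_nonneg : 0 ≤ ε
  green : ∀ t s, ‖greenOp S₁ P t s‖ ≤ M * Real.exp (υ * |t|) * Real.exp (-ω * |t - s|)
  gap : ∀ t s, 0 ≤ t - s → t - s ≤ 1 → ‖S₂ t s - S₁ t s‖ ≤ ε * Real.exp (-υ * |s|)

namespace IsPerturbedDichotomy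

variable {S₁ S₂ : ℝ → ℝ → X →L[ℝ] X} {P : ℝ → X →L[ℝ] X} {M υ ω ε : ℝ}

/-- On one side of the diagonal Green's operator is a propagator times an invariant projection, so
its second time can be moved along `S₁`. -/
theorem greenOp_step (h : IsPerturbedDichotomy S₁ S₂ P M υ ω ε) {t r r' : ℝ}
    (hr : r ≤ t ∧ r' ≤ t ∨ t < r ∧ t < r') (x : X) :
    greenOp S₁ P t r (S₁ r r' x) = greenOp S₁ P t r' x := by
  rcases hr with ⟨h1, h2⟩ | ⟨h1, h2⟩
  · simp [greenOp_of_le h1, greenOp_of_le h2, h.process₁.apply_apply,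
      h.splitting.comm_apply h.process₁]
  · simp [greenOp_of_lt h1, greenOp_of_lt h2, h.process₁.apply_apply,
      h.splitting.comm_apply h.process₁]

/-- The factor e^{-υ|s|} of the gap cancels the admitted growth e^{υ|s|}. -/
theorem norm_gap_apply_le (h : IsPerturbedDichotomy S₁ S₂ P M υ ω ε) {t s c : ℝ} {x : X}
    (h0 : 0 ≤ t - s) (h1 : t - s ≤ 1) (hx : ‖x‖ ≤ c * Real.exp (υ * |s|)) :
    ‖(S₂ t s - S₁ t s) x‖ ≤ ε * c := by
  refine ((S₂ t s - S₁ t s).le_of_opNorm_le_of_le (h.gap t s h0 h1) hx).trans (le_of_eq ?_)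
  have : Real.exp (-υ * |s|) * Real.exp (υ * |s|) = 1 := by
    rw [← Real.exp_add]; simp
  linear_combination ε * c * this

theorem norm_greenOp_gap_apply_le (h : IsPerturbedDichotomy S₁ S₂ P M υ ω ε) {t r s c : ℝ} {x : X}
    (h0 : 0 ≤ r - s) (h1 : r - s ≤ 1) (hx : ‖x‖ ≤ c * Real.exp (υ * |s|)) :
    ‖greenOp S₁ P t r ((S₂ r s - S₁ r s) x)‖ ≤
      M * Real.exp (υ * |t|) * Real.exp (-ω * |t - r|) * (ε * c) :=
  (greenOp S₁ P t r).le_of_opNorm_le_of_le (h.green t r) (h.norm_gap_apply_le h0 h1 hx)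

/-- Since |s| ≤ |t| + n, the bound decays like e^{-(ω-υ)n}. The index n = 0 is excluded because
Green's operator takes its stable branch on the diagonal, whereas the unstable sequence starts with
P(t)y(t). -/
theorem tendsto_zero_of_weighted (h : IsPerturbedDichotomy S₁ S₂ P M υ ω ε) (t C : ℝ)
    (hC : 0 ≤ C) {a : ℕ → X} (ha : ∀ n : ℕ, 1 ≤ n → ∃ s, |t - s| = n ∧
      ‖a n‖ ≤ M * Real.exp (υ * |t|) * Real.exp (-ω * |t - s|) * (C * Real.exp (υ * |s|))) :
    Tendsto a atTop (𝓝 0) := by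
  have hlim : Tendsto (fun n : ℕ => M * C * Real.exp (2 * υ * |t|) *
      Real.exp (-(ω - υ) * n)) atTop (𝓝 0) := by
    have h1 : Tendsto (fun n : ℕ => -(ω - υ) * (n : ℝ)) atTop atBot :=
      tendsto_natCast_atTop_atTop.const_mul_atTop_of_neg (by linarith [h.υ_lt])
    simpa using (Real.tendsto_exp_atBot.comp h1).const_mul (M * C * Real.exp (2 * υ * |t|))
  refine squeeze_zero_norm' ?_ hlim
  filter_upwards [eventually_ge_atTop 1] with n hn
  obtain ⟨s, hs, hn⟩ := ha n hn
  refine hn.trans ?_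
  have h2 : |s| ≤ |t| + n := by
    rw [← hs]; have := abs_sub_abs_le_abs_sub s t; rw [abs_sub_comm s t] at this; linarith
  have h3 : Real.exp (υ * |t|) * Real.exp (-ω * |t - s|) * Real.exp (υ * |s|) ≤
      Real.exp (2 * υ * |t|) * Real.exp (-(ω - υ) * n) := by
    rw [← Real.exp_add, ← Real.exp_add, ← Real.exp_add, Real.exp_le_exp, hs]
    nlinarith [h.υ_pos]
  have := mul_le_mul_of_nonneg_left h3 (mul_nonneg h.M_nonneg hC)
  linarith

/-- A solution of the perturbed process which is bounded by `C e^{υ|t|}` satisfies a better bound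
of the same kind. -/
theorem norm_solution_le (h : IsPerturbedDichotomy S₁ S₂ P M υ ω ε) {y : ℝ → X} {C : ℝ}
    (hC : 0 ≤ C) (hy : ∀ t s, s ≤ t → y t = S₂ t s (y s))
    (hyC : ∀ t, ‖y t‖ ≤ C * Real.exp (υ * |t|)) (t : ℝ) :
    ‖y t‖ ≤ ε * (2 * M / (1 - Real.exp (-ω))) * C * Real.exp (υ * |t|) := by
  have hω : 0 < ω := h.υ_pos.trans h.υ_lt
  have hq : Real.exp (-ω) < 1 := by simpa using hω
  have hq' : ∀ n : ℕ, Real.exp (-ω) ^ n = Real.exp (-ω * n) := fun n => by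
    rw [← Real.exp_nat_mul, mul_comm]
  set c := M * Real.exp (υ * |t|) * (ε * C) with hc
  have hc0 : 0 ≤ c := by have := h.M_nonneg; have := h.ε_nonneg; positivity
  have hB : ∀ r, y (r + 1) = S₁ (r + 1) r (y r) + (S₂ (r + 1) r - S₁ (r + 1) r) (y r) :=
    fun r => by rw [hy (r + 1) r (by linarith)]; simp
  have hs : ‖(y t - P t (y t))‖ ≤ c / (1 - Real.exp (-ω)) := by
    -- Stable part by telescoping: without perturbation this sequence would be constant, and each
    -- increment is one gap term seen through Green's operator.
    set a : ℕ → X := fun n => greenOp S₁ P t (t - n) (y (t - n)) with ha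
    have ha0 : a 0 = y t - P t (y t) := by
      simp [ha, greenOp_of_le le_rfl, h.process₁.refl_apply]
    have hd : ∀ n, dist (a n) (a (n + 1)) ≤ c * Real.exp (-ω) ^ n := fun n => by
      have e1 := hB (t - (n + 1))
      rw [show t - ((n : ℝ) + 1) + 1 = t - n by ring] at e1
      have e2 : a n - a (n + 1) = greenOp S₁ P t (t - n)
          ((S₂ (t - n) (t - (n + 1)) - S₁ (t - n) (t - (n + 1))) (y (t - (n + 1)))) := by
        have hn : (0 : ℝ) ≤ n := n.cast_nonneg
        simp only [ha, Nat.cast_add, Nat.cast_one]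
        rw [← h.greenOp_step (r := t - n) (r' := t - (n + 1))
          (Or.inl ⟨by linarith, by linarith⟩), ← map_sub]
        congr 1
        rw [e1]; abel
      rw [dist_eq_norm, e2]
      refine (h.norm_greenOp_gap_apply_le (by linarith) (by linarith) (hyC _)).trans
        (le_of_eq ?_)
      rw [hq', hc, show |t - (t - n)| = (n : ℝ) by simp]
      ring
    have hlim := h.tendsto_zero_of_weighted t C hC (a := a) fun n _ => ⟨t - n, by simp,
      (greenOp S₁ P t (t - n)).le_of_opNorm_le_of_le (h.green _ _) (hyC _)⟩
    have := dist_le_of_le_geometric_of_tendsto₀ _ _ hq hd hlim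
    rwa [dist_zero_right, ha0] at this
  have hu : ‖P t (y t)‖ ≤ c / (1 - Real.exp (-ω)) := by
    -- The same with the future: the unstable part is pulled back from t + n. The minus sign of the
    -- unstable branch gives the increments their sign.
    set a : ℕ → X := fun n => S₁ t (t + n) (P (t + n) (y (t + n))) with ha
    have ha0 : a 0 = P t (y t) := by simp [ha, h.process₁.refl_apply]
    have hd : ∀ n, dist (a n) (a (n + 1)) ≤ c * Real.exp (-ω) ^ n := fun n => by
      have hn : (0 : ℝ) ≤ n := n.cast_nonneg
      have e1 := hB (t + n)
      have e2 : a n - a (n + 1) = greenOp S₁ P t (t + n + 1)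
          ((S₂ (t + n + 1) (t + n) - S₁ (t + n + 1) (t + n)) (y (t + n))) := by
        simp only [ha, Nat.cast_add, Nat.cast_one, ← add_assoc]
        rw [greenOp_of_lt (by linarith), e1, map_add, map_add,
          h.splitting.comm_apply h.process₁, h.process₁.apply_apply]
        simp
      rw [dist_eq_norm, e2]
      refine (h.norm_greenOp_gap_apply_le (by linarith) (by linarith) (hyC _)).trans ?_
      rw [hq', hc, show |t - (t + n + 1)| = (n : ℝ) + 1 by
        rw [show t - (t + n + 1) = -((n : ℝ) + 1) by ring, abs_neg, abs_of_pos (by linarith)]]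
      have : Real.exp (-ω * (n + 1)) ≤ Real.exp (-ω * n) := by
        rw [Real.exp_le_exp]; linarith
      have := mul_le_mul_of_nonneg_left this hc0
      rw [hc] at this
      linarith
    have hlim := h.tendsto_zero_of_weighted t C hC (a := a) fun n hn => ⟨t + n, by simp, by
      have hn' : (1 : ℝ) ≤ n := by exact_mod_cast hn
      have := (greenOp S₁ P t (t + n)).le_of_opNorm_le_of_le (h.green _ _) (hyC (t + n))
      rwa [greenOp_of_lt (by linarith), neg_apply, norm_neg] at this⟩
    have := dist_le_of_le_geometric_of_tendsto₀ _ _ hq hd hlim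
    rwa [dist_zero_right, ha0] at this
  have h2 := norm_add_le (y t - P t (y t)) (P t (y t))
  rw [sub_add_cancel] at h2
  refine h2.trans ((add_le_add hs hu).trans (le_of_eq ?_))
  rw [hc]; ring

/-- The perturbed process has no nonzero solution bounded by a multiple of `e^{υ|t|}`. -/
theorem solution_eq_zero (h : IsPerturbedDichotomy S₁ S₂ P M υ ω ε)
    (hε : ε * (2 * M / (1 - Real.exp (-ω))) < 1) {y : ℝ → X} {C : ℝ}
    (hy : ∀ t s, s ≤ t → y t = S₂ t s (y s))
    (hyC : ∀ t, ‖y t‖ ≤ C * Real.exp (υ * |t|)) (t : ℝ) : y t = 0 := by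
  have hω : 0 < ω := h.υ_pos.trans h.υ_lt
  have hq : 0 < 1 - Real.exp (-ω) := by simpa using hω
  set ρ := ε * (2 * M / (1 - Real.exp (-ω))) with hρ
  have hρ0 : 0 ≤ ρ := by have := h.M_nonneg; have := h.ε_nonneg; positivity
  have hC : 0 ≤ C := by
    have := (norm_nonneg _).trans (hyC 0); simpa using this
  have hn : ∀ n : ℕ, ∀ t, ‖y t‖ ≤ ρ ^ n * C * Real.exp (υ * |t|) := by
    intro n
    induction n with
    | zero => simpa using hyC
    | succ n ih =>
      intro t
      refine (h.norm_solution_le (by positivity) hy ih t).trans (le_of_eq ?_)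
      rw [pow_succ']; ring
  have hlim : Tendsto (fun n : ℕ => ρ ^ n * C * Real.exp (υ * |t|)) atTop (𝓝 0) := by
    have := (tendsto_pow_atTop_nhds_zero_of_lt_one hρ0 hε).mul_const (C * Real.exp (υ * |t|))
    simpa [mul_assoc] using this
  exact norm_le_zero_iff.1 (ge_of_tendsto' hlim fun n => hn n t)

end IsPerturbedDichotomy

end Robustness

/-! ### Construction of Green's operator of the perturbed process. -/

section Robustness

variable {X : Type*} [NormedAddCommGroup X] [NormedSpace ℝ X]

/-- The contribution of the perturbation on `[s + k, s + k + 1]` at time `t`, if the solution takes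
the value `Q` at time `s + k`. -/
noncomputable def greenTerm (S₁ S₂ : ℝ → ℝ → X →L[ℝ] X) (P : ℝ → X →L[ℝ] X) (s t : ℝ) (k : ℤ)
    (Q : X →L[ℝ] X) : X →L[ℝ] X :=
  (greenOp S₁ P t (s + k + 1)).comp ((S₂ (s + k + 1) (s + k) - S₁ (s + k + 1) (s + k)).comp Q)

/-- The last point not after `t` of the grid `s + ℤ`. -/
noncomputable def gridFloor (s t : ℝ) : ℝ := s + ⌊t - s⌋

/-- The map whose fixed point is Green's operator `t ↦ G₂(t, s)` of the perturbed process. -/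
noncomputable def perturbationMap (S₁ S₂ : ℝ → ℝ → X →L[ℝ] X) (P : ℝ → X →L[ℝ] X) (s : ℝ)
    (z : ℝ → X →L[ℝ] X) (t : ℝ) : X →L[ℝ] X :=
  greenOp S₁ P t s + ∑' k : ℤ, greenTerm S₁ S₂ P s t k (z (s + k)) +
    (S₂ t (gridFloor s t) - S₁ t (gridFloor s t)).comp (z (gridFloor s t))

/-- The weight `e^{υ|t|} e^{-(ω-υ)|t-s|}`. -/
noncomputable def greenWeight (υ ω s t : ℝ) : ℝ :=
  Real.exp (υ * |t|) * Real.exp (-(ω - υ) * |t - s|)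

/-- The factor of `ε` in the contraction constant of `perturbationMap`. -/
noncomputable def contractionConst (M υ ω : ℝ) : ℝ :=
  M * Real.exp ω * (∑' k : ℤ, Real.exp (-υ * |(k : ℝ)|)) + Real.exp ω

theorem contractionConst_nonneg {M : ℝ} (hM : 0 ≤ M) (υ ω : ℝ) : 0 ≤ contractionConst M υ ω := by
  have : 0 ≤ ∑' k : ℤ, Real.exp (-υ * |(k : ℝ)|) := tsum_nonneg fun _ => (Real.exp_pos _).le
  unfold contractionConst; positivity

theorem greenWeight_pos (υ ω s t : ℝ) : 0 < greenWeight υ ω s t := by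
  unfold greenWeight; positivity

theorem gridFloor_le (s t : ℝ) : gridFloor s t ≤ t := by
  unfold gridFloor; linarith [Int.floor_le (t - s)]

theorem lt_gridFloor_add_one (s t : ℝ) : t < gridFloor s t + 1 := by
  unfold gridFloor; linarith [Int.lt_floor_add_one (t - s)]

namespace IsPerturbedDichotomy

variable {S₁ S₂ : ℝ → ℝ → X →L[ℝ] X} {P : ℝ → X →L[ℝ] X} {M υ ω ε : ℝ}

theorem norm_gap_comp_le (h : IsPerturbedDichotomy S₁ S₂ P M υ ω ε) {C s r t : ℝ}
    {Q : X →L[ℝ] X} (h0 : 0 ≤ t - r) (h1 : t - r ≤ 1) (hQ : ‖Q‖ ≤ C * greenWeight υ ω s r) :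
    ‖(S₂ t r - S₁ t r).comp Q‖ ≤ ε * C * Real.exp (-(ω - υ) * |r - s|) := by
  refine (ContinuousLinearMap.opNorm_comp_le _ _).trans
    ((mul_le_mul (h.gap t r h0 h1) hQ (norm_nonneg _)
      (mul_nonneg h.ε_nonneg (Real.exp_pos _).le)).trans (le_of_eq ?_))
  have : Real.exp (-υ * |r|) * Real.exp (υ * |r|) = 1 := by
    rw [← Real.exp_add]; simp
  unfold greenWeight
  linear_combination ε * C * Real.exp (-(ω - υ) * |r - s|) * this

/-- Of the decay rate ω of Green's operator, ω - υ is spent, by the triangle inequality, on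
restoring the decay of the weight in |t - s|; the rest, υ, makes the series over k summable. The
unit length of a grid step costs e^{ω-υ}. -/
theorem norm_greenTerm_le (h : IsPerturbedDichotomy S₁ S₂ P M υ ω ε) {C : ℝ} (hC : 0 ≤ C)
    (s t : ℝ) (k : ℤ) {Q : X →L[ℝ] X} (hQ : ‖Q‖ ≤ C * greenWeight υ ω s (s + k)) :
    ‖greenTerm S₁ S₂ P s t k Q‖ ≤
      ε * C * M * Real.exp (ω - υ) * greenWeight υ ω s t * Real.exp (-υ * |t - s - 1 - k|) := by
  have hM := h.M_nonneg
  have hε := h.ε_nonneg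
  refine (ContinuousLinearMap.opNorm_comp_le _ _).trans
    ((mul_le_mul (h.green t (s + k + 1)) (h.norm_gap_comp_le (by linarith) (by linarith) hQ)
      (norm_nonneg _) (by positivity)).trans ?_)
  have h1 : Real.exp (-ω * |t - (s + k + 1)|) * Real.exp (-(ω - υ) * |s + k - s|) ≤
      Real.exp (ω - υ) * Real.exp (-(ω - υ) * |t - s|) * Real.exp (-υ * |t - s - 1 - k|) := by
    rw [← Real.exp_add, ← Real.exp_add, ← Real.exp_add, Real.exp_le_exp]
    have e1 : t - (s + k + 1) = t - s - 1 - k := by ring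
    have e2 : |t - s| ≤ |t - s - 1 - k| + |s + k - s| + 1 := by
      have := abs_add_three (t - s - 1 - k) (s + k - s) 1
      rwa [abs_one, show t - s - 1 - k + (s + k - s) + 1 = t - s by ring] at this
    rw [e1]
    nlinarith [h.υ_lt]
  have h2 := mul_le_mul_of_nonneg_left h1
    (show 0 ≤ M * Real.exp (υ * |t|) * (ε * C) by positivity)
  unfold greenWeight
  linarith

theorem summable_greenTerm [CompleteSpace X] (h : IsPerturbedDichotomy S₁ S₂ P M υ ω ε) {C : ℝ}
    (hC : 0 ≤ C) (s t : ℝ) {z : ℝ → X →L[ℝ] X} (hz : ∀ t, ‖z t‖ ≤ C * greenWeight υ ω s t) :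
    Summable fun k : ℤ => greenTerm S₁ S₂ P s t k (z (s + k)) :=
  Summable.of_norm_bounded ((summable_exp_neg_mul_abs_sub h.υ_pos (t - s - 1)).mul_left _)
    fun k => h.norm_greenTerm_le hC s t k (hz _)

theorem norm_tsum_greenTerm_le [CompleteSpace X] (h : IsPerturbedDichotomy S₁ S₂ P M υ ω ε)
    {C : ℝ} (hC : 0 ≤ C) (s t : ℝ) {z : ℝ → X →L[ℝ] X}
    (hz : ∀ t, ‖z t‖ ≤ C * greenWeight υ ω s t) :
    ‖∑' k : ℤ, greenTerm S₁ S₂ P s t k (z (s + k))‖ ≤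
      ε * (M * Real.exp ω * ∑' k : ℤ, Real.exp (-υ * |(k : ℝ)|)) * C * greenWeight υ ω s t := by
  have hM := h.M_nonneg
  have hε := h.ε_nonneg
  have hw := (greenWeight_pos υ ω s t).le
  refine (tsum_of_norm_bounded
    ((summable_exp_neg_mul_abs_sub h.υ_pos (t - s - 1)).mul_left _).hasSum
    fun k => h.norm_greenTerm_le hC s t k (hz _)).trans ?_
  rw [tsum_mul_left]
  refine (mul_le_mul_of_nonneg_left (tsum_exp_neg_mul_abs_sub_le h.υ_pos (t - s - 1))
    (by positivity)).trans (le_of_eq ?_)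
  have : Real.exp (ω - υ) * Real.exp υ = Real.exp ω := by rw [← Real.exp_add]; simp
  rw [← this]; ring

theorem norm_gap_gridFloor_comp_le (h : IsPerturbedDichotomy S₁ S₂ P M υ ω ε) {C : ℝ}
    (hC : 0 ≤ C) (s t : ℝ) {Q : X →L[ℝ] X} (hQ : ‖Q‖ ≤ C * greenWeight υ ω s (gridFloor s t)) :
    ‖(S₂ t (gridFloor s t) - S₁ t (gridFloor s t)).comp Q‖ ≤
      ε * Real.exp ω * C * greenWeight υ ω s t := by
  have hε := h.ε_nonneg
  have g1 := gridFloor_le s t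
  have g2 := lt_gridFloor_add_one s t
  refine (h.norm_gap_comp_le (by linarith) (by linarith) hQ).trans ?_
  have h1 : Real.exp (-(ω - υ) * |gridFloor s t - s|) ≤ Real.exp ω * greenWeight υ ω s t := by
    unfold greenWeight
    rw [← Real.exp_add, ← Real.exp_add, Real.exp_le_exp]
    have e : |t - s| ≤ |gridFloor s t - s| + 1 := by
      have := abs_add_le (gridFloor s t - s) (t - gridFloor s t)
      rw [abs_of_nonneg (show 0 ≤ t - gridFloor s t by linarith)] at this
      rw [show gridFloor s t - s + (t - gridFloor s t) = t - s by ring] at this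
      linarith
    nlinarith [h.υ_lt, h.υ_pos, abs_nonneg t]
  have := mul_le_mul_of_nonneg_left h1 (mul_nonneg hε hC)
  linarith

/-- Green's operator of the perturbed process exists as a fixed point of `perturbationMap`. -/
theorem exists_fixedPoint [CompleteSpace X] (h : IsPerturbedDichotomy S₁ S₂ P M υ ω ε)
    (hε : ε * contractionConst M υ ω < 1) (s : ℝ) :
    ∃ z : ℝ → X →L[ℝ] X,
      (∀ t, ‖z t‖ ≤ M / (1 - ε * contractionConst M υ ω) * greenWeight υ ω s t) ∧
        perturbationMap S₁ S₂ P s z = z := by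
  refine exists_fixedPoint_of_weighted_contraction (greenWeight υ ω s) _ h.M_nonneg
    (mul_nonneg h.ε_nonneg (contractionConst_nonneg h.M_nonneg υ ω)) hε (fun t => ?_) ?_
  · have h0 : perturbationMap S₁ S₂ P s 0 t = greenOp S₁ P t s := by
      simp [perturbationMap, greenTerm]
    rw [h0]
    refine (h.green t s).trans ?_
    unfold greenWeight
    rw [mul_assoc]
    refine mul_le_mul_of_nonneg_left (mul_le_mul_of_nonneg_left (Real.exp_le_exp.2 ?_)
      (Real.exp_pos _).le) h.M_nonneg
    nlinarith [h.υ_pos, abs_nonneg (t - s)]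
  · rintro z z' ⟨C₁, h1⟩ ⟨C₂, h2⟩ C hC hd t
    have nonneg : ∀ {c : ℝ} {Q : X →L[ℝ] X}, ‖Q‖ ≤ c * greenWeight υ ω s s → 0 ≤ c :=
      fun hQ => nonneg_of_mul_nonneg_left ((norm_nonneg _).trans hQ) (greenWeight_pos υ ω s s)
    -- The map is affine only where the series converge, hence the use of the weighted bounds of
    -- both z and z'.
    have e : perturbationMap S₁ S₂ P s z t - perturbationMap S₁ S₂ P s z' t =
        ∑' k : ℤ, greenTerm S₁ S₂ P s t k ((z - z') (s + k)) +
          (S₂ t (gridFloor s t) - S₁ t (gridFloor s t)).comp ((z - z') (gridFloor s t)) := by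
      have e1 : ∀ k : ℤ, greenTerm S₁ S₂ P s t k ((z - z') (s + k)) =
          greenTerm S₁ S₂ P s t k (z (s + k)) - greenTerm S₁ S₂ P s t k (z' (s + k)) := fun k => by
        simp [greenTerm, ContinuousLinearMap.comp_sub]
      simp_rw [e1]
      rw [(h.summable_greenTerm (nonneg (h1 s)) s t h1).tsum_sub
        (h.summable_greenTerm (nonneg (h2 s)) s t h2), Pi.sub_apply, ContinuousLinearMap.comp_sub]
      unfold perturbationMap
      abel
    rw [e]
    refine (norm_add_le _ _).trans ((add_le_add (h.norm_tsum_greenTerm_le hC s t hd)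
      (h.norm_gap_gridFloor_comp_le hC s t (hd _))).trans (le_of_eq ?_))
    unfold contractionConst
    ring

section FixedPoint

variable [CompleteSpace X] {s C : ℝ} {z : ℝ → X →L[ℝ] X}

/-- The free propagation of a fixed point of `perturbationMap`, within one grid step. -/
theorem comp_perturbationMap_sub (h : IsPerturbedDichotomy S₁ S₂ P M υ ω ε) (hC : 0 ≤ C)
    (hz : ∀ t, ‖z t‖ ≤ C * greenWeight υ ω s t) (hfix : perturbationMap S₁ S₂ P s z = z)
    (m : ℤ) {t : ℝ} (ht : s + m ≤ t) :
    (S₁ t (s + m)).comp (z (s + m)) =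
      (greenOp S₁ P t s - if s + m < s ∧ s ≤ t then S₁ t s else 0) +
      ∑' k : ℤ, (greenTerm S₁ S₂ P s t k (z (s + k)) -
        if s + m < s + k + 1 ∧ s + k + 1 ≤ t then (S₁ t (s + k + 1)).comp
          ((S₂ (s + k + 1) (s + k) - S₁ (s + k + 1) (s + k)).comp (z (s + k))) else 0) := by
  have hm : gridFloor s (s + m) = s + m := by simp [gridFloor]
  have e0 : S₂ (s + m) (s + m) - S₁ (s + m) (s + m) = 0 := by
    rw [h.process₁.refl, h.process₂.refl, sub_self]
  conv_lhs => rw [← hfix, perturbationMap, hm, e0, ContinuousLinearMap.zero_comp, add_zero,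
    ContinuousLinearMap.comp_add, h.process₁.comp_greenOp ht]
  congr 1
  have := (ContinuousLinearMap.compL ℝ X X X (S₁ t (s + m))).map_tsum
    (h.summable_greenTerm hC s (s + m) hz)
  rw [ContinuousLinearMap.compL_apply] at this
  rw [this]
  refine tsum_congr fun k => ?_
  rw [ContinuousLinearMap.compL_apply, greenTerm, ← ContinuousLinearMap.comp_assoc,
    h.process₁.comp_greenOp ht, ContinuousLinearMap.sub_comp, greenTerm]
  congr 1
  split_ifs <;> simp

/-- No grid point lies strictly after `gridFloor s t` and up to t, so no term jumps on the way: the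
Green part of z(t) is S₁ applied to the value at the floor, and the last term of the map changes S₁
into S₂. -/
theorem fixedPoint_eq_of_gridFloor (h : IsPerturbedDichotomy S₁ S₂ P M υ ω ε) (hC : 0 ≤ C)
    (hz : ∀ t, ‖z t‖ ≤ C * greenWeight υ ω s t) (hfix : perturbationMap S₁ S₂ P s z = z)
    (t : ℝ) : z t = (S₂ t (gridFloor s t)).comp (z (gridFloor s t)) := by
  have h1 := gridFloor_le s t
  have h2 := lt_gridFloor_add_one s t
  have key := h.comp_perturbationMap_sub hC hz hfix ⌊t - s⌋ h1
  have n1 : ¬ (s + ⌊t - s⌋ < s ∧ s ≤ t) := by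
    rintro ⟨h3, h4⟩
    have : (0 : ℝ) ≤ ⌊t - s⌋ := by exact_mod_cast Int.floor_nonneg.2 (by linarith)
    linarith
  have n2 : ∀ k : ℤ, ¬ (s + ⌊t - s⌋ < s + k + 1 ∧ s + k + 1 ≤ t) := by
    rintro k ⟨h3, h4⟩
    have h5 : k + 1 ≤ ⌊t - s⌋ := Int.le_floor.2 (by push_cast; linarith)
    have h6 : (k : ℝ) + 1 ≤ ⌊t - s⌋ := by exact_mod_cast h5
    linarith
  simp only [n1, n2, if_false, sub_zero] at key
  conv_lhs => rw [← hfix, perturbationMap, ← key]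
  change (S₁ t (gridFloor s t)).comp (z (gridFloor s t)) + _ = _
  rw [ContinuousLinearMap.sub_comp]
  abel

/-- Over one grid step only the series term k = m jumps, at the right endpoint, which changes S₁
into S₂. The free term jumps only when that endpoint is s, that is for m = -1, and contributes the
identity. -/
theorem fixedPoint_grid_succ (h : IsPerturbedDichotomy S₁ S₂ P M υ ω ε) (hC : 0 ≤ C)
    (hz : ∀ t, ‖z t‖ ≤ C * greenWeight υ ω s t) (hfix : perturbationMap S₁ S₂ P s z = z)
    (m : ℤ) : z (s + (m + 1 : ℤ)) = (S₂ (s + (m + 1 : ℤ)) (s + m)).comp (z (s + m)) +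
      if m = -1 then ContinuousLinearMap.id ℝ X else 0 := by
  set t : ℝ := s + (m + 1 : ℤ) with ht
  have ht' : t = s + m + 1 := by rw [ht]; push_cast; ring
  have key := h.comp_perturbationMap_sub hC hz hfix m (t := t) (by linarith)
  have hfl : gridFloor s t = t := by simp [gridFloor, ht]
  have e0 : S₂ t t - S₁ t t = 0 := by rw [h.process₁.refl, h.process₂.refl, sub_self]
  have hzt : z t = greenOp S₁ P t s + ∑' k : ℤ, greenTerm S₁ S₂ P s t k (z (s + k)) := by
    conv_lhs => rw [← hfix, perturbationMap, hfl, e0, ContinuousLinearMap.zero_comp, add_zero]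
  have c1 : (if s + m < s ∧ s ≤ t then S₁ t s else 0) =
      if m = -1 then ContinuousLinearMap.id ℝ X else 0 := by
    by_cases hm : m = -1
    · have hts : t = s := by rw [ht', hm]; push_cast; ring
      rw [if_pos hm, if_pos ⟨by rw [hm]; push_cast; linarith, hts.ge⟩, hts, h.process₁.refl]
    · rw [if_neg hm, if_neg]
      rintro ⟨h1, h2⟩
      have h3 : (m : ℝ) < 0 := by linarith
      have h4 : (0 : ℝ) ≤ m + 1 := by linarith
      have h3' : m < 0 := by exact_mod_cast h3
      have h4' : 0 ≤ m + 1 := by exact_mod_cast h4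
      omega
  have c2 : ∀ k : ℤ, (if s + m < s + k + 1 ∧ s + k + 1 ≤ t then (S₁ t (s + k + 1)).comp
      ((S₂ (s + k + 1) (s + k) - S₁ (s + k + 1) (s + k)).comp (z (s + k))) else 0) =
      if k = m then (S₂ t (s + m) - S₁ t (s + m)).comp (z (s + m)) else 0 := fun k => by
    by_cases hk : k = m
    · subst hk
      rw [if_pos rfl, if_pos ⟨by linarith, ht'.ge⟩, ← ht', h.process₁.refl,
        ContinuousLinearMap.id_comp]
    · rw [if_neg hk, if_neg]
      rintro ⟨h1, h2⟩
      have h3 : (m : ℝ) < k + 1 := by linarith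
      have h4 : (k : ℝ) ≤ m := by linarith
      have h3' : m < k + 1 := by exact_mod_cast h3
      have h4' : k ≤ m := by exact_mod_cast h4
      omega
  have hsum : Summable fun k : ℤ =>
      if k = m then (S₂ t (s + m) - S₁ t (s + m)).comp (z (s + m)) else 0 :=
    (hasSum_ite_eq m _).summable
  simp_rw [c1, c2] at key
  rw [(h.summable_greenTerm hC s t hz).tsum_sub hsum, tsum_ite_eq,
    ContinuousLinearMap.sub_comp] at key
  rw [hzt]
  rw [sub_add_sub_comm, eq_sub_iff_add_eq] at key
  rw [← key]
  abel

theorem fixedPoint_grid_of_nonneg (h : IsPerturbedDichotomy S₁ S₂ P M υ ω ε) (hC : 0 ≤ C)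
    (hz : ∀ t, ‖z t‖ ≤ C * greenWeight υ ω s t) (hfix : perturbationMap S₁ S₂ P s z = z)
    (n : ℕ) : z (s + n) = (S₂ (s + n) s).comp (z s) := by
  induction n with
  | zero => simp [h.process₂.refl]
  | succ n ih =>
    have := h.fixedPoint_grid_succ hC hz hfix n
    rw [if_neg (by omega), add_zero] at this
    push_cast at this ⊢
    rw [this, ih, ← ContinuousLinearMap.comp_assoc, h.process₂.comp_comp]

/-- The step m = -1, which ends at s, brings in the identity; all earlier steps are inverted by
`S₂`. -/
theorem fixedPoint_grid_of_neg (h : IsPerturbedDichotomy S₁ S₂ P M υ ω ε) (hC : 0 ≤ C)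
    (hz : ∀ t, ‖z t‖ ≤ C * greenWeight υ ω s t) (hfix : perturbationMap S₁ S₂ P s z = z)
    (n : ℕ) : z (s - (n + 1)) = (S₂ (s - (n + 1)) s).comp (z s - ContinuousLinearMap.id ℝ X) := by
  induction n with
  | zero =>
    have := h.fixedPoint_grid_succ hC hz hfix (-1)
    simp only [Int.reduceNeg, neg_add_cancel, Int.cast_zero, add_zero, if_true, Int.cast_neg,
      Int.cast_one] at this
    simp only [Nat.cast_zero, zero_add, sub_eq_add_neg] at this ⊢
    rw [this, add_neg_cancel_right, ← ContinuousLinearMap.comp_assoc, h.process₂.comp_comp,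
      h.process₂.refl, ContinuousLinearMap.id_comp]
  | succ n ih =>
    have := h.fixedPoint_grid_succ hC hz hfix (-(n + 2))
    rw [if_neg (by omega), add_zero] at this
    have e1 : s + ((-((n : ℤ) + 2) + 1 : ℤ) : ℝ) = s - (n + 1) := by push_cast; ring
    have e2 : s + ((-((n : ℤ) + 2) : ℤ) : ℝ) = s - ((n + 1 : ℕ) + 1) := by push_cast; ring
    rw [e1, e2] at this
    have := congrArg (fun Q => (S₂ (s - ((n + 1 : ℕ) + 1)) (s - (n + 1))).comp Q) this
    simp only [← ContinuousLinearMap.comp_assoc, h.process₂.comp_comp, h.process₂.refl,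
      ContinuousLinearMap.id_comp] at this
    rw [← this, ih, ← ContinuousLinearMap.comp_assoc, h.process₂.comp_comp]

theorem fixedPoint_of_le (h : IsPerturbedDichotomy S₁ S₂ P M υ ω ε) (hC : 0 ≤ C)
    (hz : ∀ t, ‖z t‖ ≤ C * greenWeight υ ω s t) (hfix : perturbationMap S₁ S₂ P s z = z)
    {t : ℝ} (ht : s ≤ t) : z t = (S₂ t s).comp (z s) := by
  obtain ⟨n, hn⟩ := Int.eq_ofNat_of_zero_le (Int.floor_nonneg.2 (sub_nonneg.2 ht))
  rw [h.fixedPoint_eq_of_gridFloor hC hz hfix t, gridFloor, hn, Int.cast_natCast,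
    h.fixedPoint_grid_of_nonneg hC hz hfix n, ← ContinuousLinearMap.comp_assoc,
    h.process₂.comp_comp]

theorem fixedPoint_of_lt (h : IsPerturbedDichotomy S₁ S₂ P M υ ω ε) (hC : 0 ≤ C)
    (hz : ∀ t, ‖z t‖ ≤ C * greenWeight υ ω s t) (hfix : perturbationMap S₁ S₂ P s z = z)
    {t : ℝ} (ht : t < s) : z t = (S₂ t s).comp (z s - ContinuousLinearMap.id ℝ X) := by
  obtain ⟨n, hn⟩ : ∃ n : ℕ, ⌊t - s⌋ = -((n : ℤ) + 1) := by
    have : ⌊t - s⌋ < 0 := Int.floor_lt.2 (by simpa using ht)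
    exact ⟨(-⌊t - s⌋ - 1).toNat, by omega⟩
  have e : gridFloor s t = s - (n + 1) := by rw [gridFloor, hn]; push_cast; ring
  rw [h.fixedPoint_eq_of_gridFloor hC hz hfix t, e, h.fixedPoint_grid_of_neg hC hz hfix n,
    ← ContinuousLinearMap.comp_assoc, h.process₂.comp_comp]

end FixedPoint

end IsPerturbedDichotomy

end Robustness

/-! ### The perturbed splitting, and passage to the dual. -/

section Robustness

variable {X : Type*} [NormedAddCommGroup X] [NormedSpace ℝ X]

/-- A bound for `S(t,s) Q`, `t < s`, extends to `t = s` by strong continuity. -/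
theorem IsInvertibleEvolutionProcess.norm_le_of_forall_lt {S : ℝ → ℝ → X →L[ℝ] X}
    (h : IsInvertibleEvolutionProcess S) {Q : X →L[ℝ] X} {s : ℝ} {f : ℝ → ℝ} (hf : Continuous f)
    (hb : ∀ t, t < s → ‖(S t s).comp Q‖ ≤ f t) : ‖Q‖ ≤ f s := by
  have hmem : ∀ᶠ t in 𝓝[<] s, t < s := eventually_mem_nhdsWithin
  have hflim : Tendsto f (𝓝[<] s) (𝓝 (f s)) := (hf.tendsto s).mono_left nhdsWithin_le_nhds
  refine Q.opNorm_le_bound (ge_of_tendsto hflim ?_) fun x => ?_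
  · filter_upwards [hmem] with t ht using (norm_nonneg _).trans (hb t ht)
  · have hc : Continuous fun t => S t s (Q x) :=
      (h.continuous_apply (Q x)).comp (f := fun t : ℝ => (t, s)) (by fun_prop)
    have hlim : Tendsto (fun t => ‖S t s (Q x)‖) (𝓝[<] s) (𝓝 ‖Q x‖) := by
      have := (hc.norm.tendsto s).mono_left (nhdsWithin_le_nhds (s := Set.Iio s))
      rwa [h.refl_apply] at this
    refine le_of_tendsto_of_tendsto hlim (hflim.mul_const ‖x‖) ?_
    filter_upwards [hmem] with t ht
    exact ((S t s).comp Q).le_of_opNorm_le (hb t ht) x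

namespace IsPerturbedDichotomy

variable {S₁ S₂ : ℝ → ℝ → X →L[ℝ] X} {P : ℝ → X →L[ℝ] X} {M υ ω ε : ℝ}

/-- A vector whose orbit is bounded by multiples of `e^{υ|t|}` in the past and in the future
vanishes. -/
theorem eq_zero_of_orbit_bounded (h : IsPerturbedDichotomy S₁ S₂ P M υ ω ε)
    (hε : ε * (2 * M / (1 - Real.exp (-ω))) < 1) {s a b C₁ C₂ : ℝ} {x : X}
    (hb : ∀ t, b ≤ t → ‖S₂ t s x‖ ≤ C₁ * Real.exp (υ * |t|))
    (ha : ∀ t, t ≤ a → ‖S₂ t s x‖ ≤ C₂ * Real.exp (υ * |t|)) : x = 0 := by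
  have hc : Continuous fun t => S₂ t s x :=
    (h.process₂.continuous_apply x).comp (f := fun t : ℝ => (t, s)) (by fun_prop)
  obtain ⟨C₃, h3⟩ := (isCompact_Icc (a := a) (b := b)).exists_bound_of_continuousOn hc.continuousOn
  have h0 := h.solution_eq_zero hε (y := fun t => S₂ t s x) (C := max C₁ (max C₂ (max C₃ 0)))
    (fun t r _ => (h.process₂.apply_apply t r s x).symm) (fun t => ?_) s
  · simpa [h.process₂.refl_apply] using h0
  · have he := Real.exp_pos (υ * |t|)
    rcases le_total b t with hbt | hbt
    · exact (hb t hbt).trans (mul_le_mul_of_nonneg_right (by simp) he.le)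
    rcases le_total t a with hat | hat
    · exact (ha t hat).trans (mul_le_mul_of_nonneg_right (by simp) he.le)
    -- Between a and b the compactness bound suffices, as the weight is at least 1.
    have h1 : (1 : ℝ) ≤ Real.exp (υ * |t|) :=
      Real.one_le_exp (mul_nonneg h.υ_pos.le (abs_nonneg t))
    refine (h3 t ⟨hat, hbt⟩).trans ((show C₃ ≤ max C₃ 0 by simp).trans
      ((le_mul_of_one_le_right (by simp) h1).trans (mul_le_mul_of_nonneg_right (by simp) he.le)))

/-- Robustness: the perturbed process has a dichotomy with the same nonuniformity `e^{υ|t|}` at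
the final time and exponent `ω - υ`. -/
theorem exists_splitting [CompleteSpace X] (h : IsPerturbedDichotomy S₁ S₂ P M υ ω ε)
    (hε : ε * (2 * M / (1 - Real.exp (-ω))) < 1) (hε' : ε * contractionConst M υ ω < 1) :
    ∃ P₂ : ℝ → X →L[ℝ] X, IsInvariantSplitting S₂ P₂ ∧
      (∀ t s, s ≤ t → ‖(S₂ t s).comp (ContinuousLinearMap.id ℝ X - P₂ s)‖ ≤
        M / (1 - ε * contractionConst M υ ω) *
          (Real.exp (υ * |t|) * Real.exp (-(ω - υ) * (t - s)))) ∧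
      (∀ t s, t ≤ s → ‖(S₂ t s).comp (P₂ s)‖ ≤
        M / (1 - ε * contractionConst M υ ω) *
          (Real.exp (υ * |t|) * Real.exp ((ω - υ) * (t - s)))) := by
  choose z hz hfix using h.exists_fixedPoint hε'
  set C := M / (1 - ε * contractionConst M υ ω) with hCdef
  have hC : 0 ≤ C := div_nonneg h.M_nonneg (by linarith)
  set Q : ℝ → X →L[ℝ] X := fun s => z s s with hQ
  have hbs : ∀ t s, s ≤ t → ‖(S₂ t s).comp (Q s)‖ ≤
      C * (Real.exp (υ * |t|) * Real.exp (-(ω - υ) * (t - s))) := fun t s hst => by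
    have := hz s t
    rwa [h.fixedPoint_of_le hC (hz s) (hfix s) hst, greenWeight,
      abs_of_nonneg (sub_nonneg.2 hst)] at this
  have hbu' : ∀ t s, t < s → ‖(S₂ t s).comp (ContinuousLinearMap.id ℝ X - Q s)‖ ≤
      C * (Real.exp (υ * |t|) * Real.exp ((ω - υ) * (t - s))) := fun t s hts => by
    have := hz s t
    rwa [h.fixedPoint_of_lt hC (hz s) (hfix s) hts, greenWeight, ← neg_sub
      (ContinuousLinearMap.id ℝ X), ContinuousLinearMap.comp_neg, norm_neg,
      abs_of_neg (sub_neg.2 hts), neg_mul_neg] at this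
  -- The fixed point takes its stable value on the diagonal, so t = s is recovered by strong
  -- continuity.
  have hbu : ∀ t s, t ≤ s → ‖(S₂ t s).comp (ContinuousLinearMap.id ℝ X - Q s)‖ ≤
      C * (Real.exp (υ * |t|) * Real.exp ((ω - υ) * (t - s))) := fun t s hts => by
    rcases hts.lt_or_eq with hts | rfl
    · exact hbu' t s hts
    · rw [h.process₂.refl, ContinuousLinearMap.id_comp]
      exact h.process₂.norm_le_of_forall_lt
        (f := fun r => C * (Real.exp (υ * |r|) * Real.exp ((ω - υ) * (r - t))))
        (by fun_prop) (fun r hr => hbu' r t hr)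
  have hωυ : 0 < ω - υ := sub_pos.2 h.υ_lt
  have os : ∀ t s x, s ≤ t → ‖S₂ t s (Q s x)‖ ≤ C * ‖x‖ * Real.exp (υ * |t|) :=
    fun t s x hst => by
      have h1 := ((S₂ t s).comp (Q s)).le_of_opNorm_le (hbs t s hst) x
      have h2 : Real.exp (-(ω - υ) * (t - s)) ≤ 1 := by
        rw [Real.exp_le_one_iff]; nlinarith
      have h3 := mul_le_mul_of_nonneg_left h2
        (show 0 ≤ C * ‖x‖ * Real.exp (υ * |t|) by positivity)
      refine h1.trans ?_
      linarith
  have ou : ∀ t s x, t ≤ s → ‖S₂ t s (x - Q s x)‖ ≤ C * ‖x‖ * Real.exp (υ * |t|) :=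
    fun t s x hst => by
      have h1 := ((S₂ t s).comp (ContinuousLinearMap.id ℝ X - Q s)).le_of_opNorm_le
        (hbu t s hst) x
      have h2 : Real.exp ((ω - υ) * (t - s)) ≤ 1 := by
        rw [Real.exp_le_one_iff]; nlinarith
      have h3 := mul_le_mul_of_nonneg_left h2
        (show 0 ≤ C * ‖x‖ * Real.exp (υ * |t|) by positivity)
      refine h1.trans ?_
      linarith
  -- The defect is a difference of two stable orbits, bounded in the future, and also a difference
  -- of two complementary orbits, bounded in the past; uniqueness kills it.
  have hcomm : ∀ t s x, Q t (S₂ t s x) = S₂ t s (Q s x) := fun t s x => by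
    rw [← sub_eq_zero]
    refine h.eq_zero_of_orbit_bounded hε (s := t) (a := min t s) (b := max t s)
      (C₁ := C * ‖S₂ t s x‖ + C * ‖x‖) (C₂ := C * ‖x‖ + C * ‖S₂ t s x‖)
      (fun r hr => ?_) (fun r hr => ?_)
    · rw [map_sub, h.process₂.apply_apply, add_mul]
      exact (norm_sub_le _ _).trans (add_le_add (os r t _ ((le_max_left _ _).trans hr))
        (os r s _ ((le_max_right _ _).trans hr)))
    · have e : Q t (S₂ t s x) - S₂ t s (Q s x) =
          S₂ t s (x - Q s x) - (S₂ t s x - Q t (S₂ t s x)) := by rw [map_sub]; abel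
      rw [e, map_sub, h.process₂.apply_apply, add_mul]
      exact (norm_sub_le _ _).trans (add_le_add (ou r s _ (hr.trans (min_le_right _ _)))
        (ou r t _ (hr.trans (min_le_left _ _))))
  -- Q(Qx) - Qx is bounded in the future as a difference of stable orbits, and in the past as minus
  -- the complementary part of Qx.
  have hproj : ∀ s x, Q s (Q s x) = Q s x := fun s x => by
    rw [← sub_eq_zero]
    refine h.eq_zero_of_orbit_bounded hε (s := s) (a := s) (b := s)
      (C₁ := C * ‖Q s x‖ + C * ‖x‖) (C₂ := C * ‖Q s x‖) (fun r hr => ?_) (fun r hr => ?_)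
    · rw [map_sub, add_mul]
      exact (norm_sub_le _ _).trans (add_le_add (os r s _ hr) (os r s _ hr))
    · rw [← neg_sub, map_neg, norm_neg]
      exact ou r s _ hr
  refine ⟨fun s => ContinuousLinearMap.id ℝ X - Q s,
    IsInvariantSplitting.of_comm h.process₂.refl_apply h.process₂.apply_apply
      (fun s x => ?_) (fun t s x => ?_), fun t s hst => ?_, hbu⟩
  · simp [hproj]
  · simp [hcomm]
  · simpa using hbs t s hst

end IsPerturbedDichotomy

/-- The adjoint projections split the dual family, with stable and unstable parts exchanged. -/
theorem IsInvariantSplitting.dual {S : ℝ → ℝ → X →L[ℝ] X} {P : ℝ → X →L[ℝ] X}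
    (hP : IsInvariantSplitting S P) (h : IsInvertibleEvolutionProcess S) :
    IsInvariantSplitting (dualFamily S)
      (fun t => ContinuousLinearMap.precomp ℝ (ContinuousLinearMap.id ℝ X - P t)) := by
  have hproj : ∀ t x, P t (P t x) = P t x := fun t x => DFunLike.congr_fun (hP.proj t) x
  refine IsInvariantSplitting.of_comm (fun t φ => ?_) (fun t s τ φ => ?_) (fun t φ => ?_)
    (fun t s φ => ?_) <;> ext x
  · simp [dualFamily, h.refl_apply]
  · simp [dualFamily, h.apply_apply]
  · simp [hproj]
  · simp [dualFamily, hP.comm_apply h]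

theorem norm_precomp_le (A : X →L[ℝ] X) :
    ‖(ContinuousLinearMap.precomp ℝ A : StrongDual ℝ X →L[ℝ] StrongDual ℝ X)‖ ≤ ‖A‖ :=
  ContinuousLinearMap.opNorm_le_bound _ (norm_nonneg _) fun φ => by
    rw [mul_comm]; exact φ.opNorm_comp_le A

end Robustness

/-! ### The explicit constants and their behaviour as ε tends to 0. -/

section Constants

theorem continuousAt_omegaTilde {ω : ℝ} : ContinuousAt (omegaTilde ω) 0 := by
  have : Real.cosh ω - √(Real.cosh ω ^ 2 - 1 - 2 * 0 * Real.sinh ω) ≠ 0 := by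
    rw [show Real.cosh ω ^ 2 - 1 - 2 * 0 * Real.sinh ω = Real.sinh ω ^ 2 by
      rw [Real.cosh_sq]; ring, Real.sqrt_sq_eq_abs]
    rcases abs_cases (Real.sinh ω) with ⟨h, _⟩ | ⟨h, _⟩ <;> rw [h]
    · rw [Real.cosh_sub_sinh]; positivity
    · rw [sub_neg_eq_add, Real.cosh_add_sinh]; positivity
  unfold omegaTilde
  fun_prop (disch := assumption)

theorem omegaTilde_zero {ω : ℝ} (hω : 0 < ω) : omegaTilde ω 0 = ω := by
  have h1 : Real.cosh ω ^ 2 - 1 - 2 * 0 * Real.sinh ω = Real.sinh ω ^ 2 := by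
    rw [Real.cosh_sq]; ring
  rw [omegaTilde, h1, Real.sqrt_sq (Real.sinh_pos_iff.2 hω).le, Real.cosh_sub_sinh, Real.log_exp,
    neg_neg]

/-- For ε ≥ 0 the root is at most sinh ω, so the argument of the logarithm is at least e^{-ω}. This
lets the exponent ω - υ be weakened to ω̃ - υ. -/
theorem omegaTilde_le {ω ε : ℝ} (hω : 0 < ω) (hε : 0 ≤ ε) : omegaTilde ω ε ≤ ω := by
  have hs := Real.sinh_pos_iff.2 hω
  have h1 : √(Real.cosh ω ^ 2 - 1 - 2 * ε * Real.sinh ω) ≤ Real.sinh ω := by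
    rw [Real.sqrt_le_left hs.le, Real.cosh_sq]
    nlinarith [mul_nonneg hε hs.le]
  have h2 := Real.cosh_sub_sinh ω
  have h3 : Real.exp (-ω) ≤
      Real.cosh ω - √(Real.cosh ω ^ 2 - 1 - 2 * ε * Real.sinh ω) := by linarith
  have h4 := Real.log_le_log (Real.exp_pos _) h3
  rw [Real.log_exp] at h4
  unfold omegaTilde
  linarith

theorem continuousAt_betaTilde {ω : ℝ} : ContinuousAt (betaTilde ω) 0 := by
  have h := continuousAt_omegaTilde (ω := ω)
  have : 1 + 2 * 0 * Real.sinh ω ≠ 0 := by simp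
  unfold betaTilde
  fun_prop (disch := assumption)

theorem betaTilde_zero {ω : ℝ} (hω : 0 < ω) : betaTilde ω 0 = ω := by
  simp [betaTilde, omegaTilde_zero hω]

/-- All constants are well defined for small perturbations. -/
theorem eventually_constantsWellDefined {ω : ℝ} (hω : 0 < ω) :
    ∀ᶠ ε in 𝓝 (0 : ℝ), ConstantsWellDefined ω ε := by
  have hs := Real.sinh_pos_iff.2 hω
  have hΩ := continuousAt_omegaTilde (ω := ω)
  have hB := continuousAt_betaTilde (ω := ω)
  have hq : Real.exp (-ω - ω) < 1 := by rw [Real.exp_lt_one_iff]; linarith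
  have n1 : 1 - Real.exp (-ω - omegaTilde ω 0) ≠ 0 := by
    rw [omegaTilde_zero hω]; linarith
  have n2 : 1 - Real.exp (-ω - betaTilde ω 0) ≠ 0 := by
    rw [betaTilde_zero hω]; linarith
  have pos : ∀ {f : ℝ → ℝ}, ContinuousAt f 0 → 0 < f 0 → ∀ᶠ ε in 𝓝 (0 : ℝ), 0 < f ε :=
    fun hf h0 => hf.eventually_const_lt h0
  have c1 : ContinuousAt (fun ε => Real.cosh ω ^ 2 - 1 - 2 * ε * Real.sinh ω) 0 := by fun_prop
  have c2 : ContinuousAt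
      (fun ε => Real.cosh ω - √(Real.cosh ω ^ 2 - 1 - 2 * ε * Real.sinh ω)) 0 := by fun_prop
  have c3 : ContinuousAt (fun ε => 1 + 2 * ε * Real.sinh ω) 0 := by fun_prop
  have c4 : ContinuousAt (rhoConst ω) 0 := by unfold rhoConst; fun_prop
  have c5 : ContinuousAt (fun ε => 1 - Real.exp (-ω - omegaTilde ω ε)) 0 := by fun_prop
  have c6 : ContinuousAt (fun ε => 1 - Real.exp (-ω - betaTilde ω ε)) 0 := by fun_prop
  have c7 : ContinuousAt
      (fun ε => 1 - ε * Real.exp (-ω) / (1 - Real.exp (-ω - omegaTilde ω ε))) 0 := by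
    fun_prop (disch := assumption)
  have c8 : ContinuousAt
      (fun ε => 1 - ε * Real.exp (-betaTilde ω ε) / (1 - Real.exp (-ω - betaTilde ω ε))) 0 := by
    fun_prop (disch := assumption)
  have e0 : Real.cosh ω ^ 2 - 1 - 2 * 0 * Real.sinh ω = Real.sinh ω ^ 2 := by
    rw [Real.cosh_sq]; ring
  have p2 : 0 < Real.cosh ω - √(Real.cosh ω ^ 2 - 1 - 2 * 0 * Real.sinh ω) := by
    rw [e0, Real.sqrt_sq hs.le, Real.cosh_sub_sinh]; positivity
  filter_upwards [pos c1 (by rw [e0]; positivity), pos c2 p2, pos c3 (by simp),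
    c4.eventually_lt_const (show rhoConst ω 0 < 1 by simp [rhoConst]),
    pos c5 (by rw [omegaTilde_zero hω]; linarith), pos c6 (by rw [betaTilde_zero hω]; linarith),
    pos c7 (by simp), pos c8 (by simp)] with ε h1 h2 h3 h4 h5 h6 h7 h8
  exact ⟨h1, h2, h3, h4, h5, h6, h7, h8⟩

theorem le_mHat {M ω ε : ℝ} (hM : 0 ≤ M) (hω : 0 < ω) (hε : 0 ≤ ε)
    (h : ConstantsWellDefined ω ε) : M ≤ mHat M ω ε := by
  have hq : 0 < 1 - Real.exp (-ω) := by simpa using hω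
  have hρ := h.rho
  have h1 : 1 ≤ mOne ω ε := by
    refine (one_le_inv₀ h.mOne_denom).2 (sub_le_self 1 ?_)
    have := h.denom_one
    positivity
  have h2 : 0 ≤ ε / ((1 - rhoConst ω ε) * (1 - Real.exp (-ω))) :=
    div_nonneg hε (mul_nonneg (by linarith) hq.le)
  have h3 : 1 ≤ (1 + ε / ((1 - rhoConst ω ε) * (1 - Real.exp (-ω)))) *
      max (mOne ω ε) (mTwo ω ε) :=
    one_le_mul_of_one_le_of_one_le (by linarith) (h1.trans (le_max_left _ _))
  unfold mHat
  rw [mul_assoc]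
  exact le_mul_of_one_le_right hM h3

/-- M ≤ M̂ and M ≥ 1 give M ≤ M̂², and L ≥ 1 makes the last factor harmless. The left side is the
majorant of the constant constructed for `S₂`. -/
theorem le_boundConst {M ω ε L : ℝ} (hM : 1 ≤ M) (hω : 0 < ω) (hε : 0 ≤ ε) (hL : 1 ≤ L)
    (h : ConstantsWellDefined ω ε) : M * Real.exp (2 * omegaTilde ω ε) ≤ boundConst M ω ε L := by
  have h1 := le_mHat (M := M) (by linarith) hω hε h
  have h2 : M ≤ mHat M ω ε ^ 2 := by nlinarith
  have h3 : 1 ≤ max L (L ^ 2) := hL.trans (le_max_left _ _)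
  unfold boundConst
  exact (mul_le_mul_of_nonneg_right h2 (Real.exp_pos _).le).trans
    (le_mul_of_one_le_right (by positivity) h3)

end Constants

/-! ### Normalizing the hypotheses, and the theorem. -/

section Robustness

variable {X : Type*} [NormedAddCommGroup X] [NormedSpace ℝ X]

theorem one_le_of_isLUB_growthSet [Nontrivial X] {S : ℝ → ℝ → X →L[ℝ] X}
    (h : ∀ t, S t t = ContinuousLinearMap.id ℝ X) {υ L : ℝ} (hL : IsLUB (growthSet υ S) L) :
    1 ≤ L :=
  hL.1 ⟨0, 0, by simp, by simp, by simp [h]⟩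

theorem eq_zero_of_proj_of_norm_lt_one {P : X →L[ℝ] X} (hP : P.comp P = P) (h1 : ‖P‖ < 1) : P = 0 := by
  have := P.opNorm_comp_le P
  rw [hP] at this
  exact norm_le_zero_iff.1 (by nlinarith [norm_nonneg P])

/-- At t = s = 0 both complementary projections have norm at most M. If M < 1, then P(0) = 0 and the
identity would have norm below 1. -/
theorem one_le_dichotomy_bound [Nontrivial X] {S : ℝ → ℝ → X →L[ℝ] X} {P : ℝ → X →L[ℝ] X}
    (h : IsInvertibleEvolutionProcess S) (hP : IsInvariantSplitting S P) {M α β δ ν : ℝ}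
    (hs : ∀ t s, s ≤ t → ‖(S t s).comp (ContinuousLinearMap.id ℝ X - P s)‖ ≤
      M * Real.exp (δ * |t|) * Real.exp (-α * (t - s)))
    (hu : ∀ t s, t < s → ‖(S t s).comp (P s)‖ ≤
      M * Real.exp (ν * |t|) * Real.exp (β * (t - s))) : 1 ≤ M := by
  by_contra! hM
  have h1 : ‖ContinuousLinearMap.id ℝ X - P 0‖ ≤ M := by
    simpa [h.refl] using hs 0 0 le_rfl
  have h2 : ‖P 0‖ ≤ M := by
    simpa using h.norm_le_of_forall_lt (s := 0) (Q := P 0)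
      (f := fun t => M * Real.exp (ν * |t|) * Real.exp (β * (t - 0))) (by fun_prop)
      (fun t ht => hu t 0 ht)
  have h3 := eq_zero_of_proj_of_norm_lt_one (hP.proj 0) (h2.trans_lt hM)
  rw [h3, sub_zero, ContinuousLinearMap.norm_id] at h1
  linarith

theorem norm_greenOp_le {S : ℝ → ℝ → X →L[ℝ] X} {P : ℝ → X →L[ℝ] X} {M α β δ ν : ℝ}
    (hM : 0 < M)
    (hs : ∀ t s, s ≤ t → ‖(S t s).comp (ContinuousLinearMap.id ℝ X - P s)‖ ≤
      M * Real.exp (δ * |t|) * Real.exp (-α * (t - s)))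
    (hu : ∀ t s, t < s → ‖(S t s).comp (P s)‖ ≤
      M * Real.exp (ν * |t|) * Real.exp (β * (t - s))) (t s : ℝ) :
    ‖greenOp S P t s‖ ≤ M * Real.exp (max δ ν * |t|) * Real.exp (-min α β * |t - s|) := by
  rcases le_or_gt s t with hst | hst
  · rw [greenOp_of_le hst, abs_of_nonneg (sub_nonneg.2 hst)]
    refine (hs t s hst).trans ?_
    gcongr
    · exact le_max_left _ _
    · exact min_le_left _ _
  · rw [greenOp_of_lt hst, norm_neg, abs_of_neg (sub_neg.2 hst), neg_mul_neg]
    refine (hu t s hst).trans ?_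
    gcongr M * Real.exp (?_ * _) * Real.exp ?_
    · exact le_max_right _ _
    · exact mul_le_mul_of_nonpos_right (min_le_right _ _) (by linarith)

theorem bddAbove_growthSet_of_gap {S₁ S₂ : ℝ → ℝ → X →L[ℝ] X} {υ ε : ℝ} (hυ : 0 < υ) (hε : 0 ≤ ε)
    (hL : BddAbove (growthSet υ S₁))
    (hgap : ∀ t s, 0 ≤ t - s → t - s ≤ 1 → ‖S₂ t s - S₁ t s‖ ≤ ε * Real.exp (-υ * |s|)) :
    BddAbove (growthSet υ S₂) := by
  obtain ⟨b, hb⟩ := hL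
  refine ⟨b + ε, ?_⟩
  rintro _ ⟨t, s, h0, h1, rfl⟩
  have e : ∀ r, Real.exp (-υ * |r|) ≤ 1 := fun r => by
    rw [Real.exp_le_one_iff]; nlinarith [abs_nonneg r]
  have h2 : ‖S₂ t s‖ ≤ ‖S₁ t s‖ + ε := by
    have h3 := norm_add_le (S₁ t s) (S₂ t s - S₁ t s)
    rw [add_sub_cancel] at h3
    exact h3.trans (by gcongr; exact (hgap t s h0 h1).trans (mul_le_of_le_one_right hε (e s)))
  have h4 : Real.exp (-υ * |t|) * ‖S₁ t s‖ ≤ b := hb ⟨t, s, h0, h1, rfl⟩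
  have h5 := mul_le_mul_of_nonneg_left h2 (Real.exp_pos (-υ * |t|)).le
  have h6 := mul_le_of_le_one_left hε (e t)
  linarith

/-- Boundedness is a separate hypothesis because `sSup` of an unbounded set of reals is 0. -/
theorem norm_sub_le_of_sSup_gapSet_lt {S₁ S₂ : ℝ → ℝ → X →L[ℝ] X} {υ ε : ℝ}
    (hb : BddAbove (gapSet υ S₁ S₂)) (hε : sSup (gapSet υ S₁ S₂) < ε) (t s : ℝ)
    (h0 : 0 ≤ t - s) (h1 : t - s ≤ 1) : ‖S₂ t s - S₁ t s‖ ≤ ε * Real.exp (-υ * |s|) := by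
  have h2 := (le_csSup hb ⟨t, s, h0, h1, rfl⟩).trans hε.le
  rw [norm_sub_rev, neg_mul, Real.exp_neg, ← div_eq_mul_inv, le_div_iff₀ (Real.exp_pos _), mul_comm]
  exact h2

end Robustness

theorem mainTheorem3 {X : Type*} [NormedAddCommGroup X] [NormedSpace ℝ X] [CompleteSpace X]
    [Nontrivial X] (S₁ : ℝ → ℝ → X →L[ℝ] X) (hS₁ : IsInvertibleEvolutionProcess S₁)
    (M υ ω : ℝ) (hυ : 0 < υ) (hυω : υ < ω) (hNED : AdmitsNEDII S₁ M υ ω)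
    (hL : BddAbove (growthSet υ S₁)) :
    ∃ ε₀ : ℝ, 0 < ε₀ ∧ ∀ ε : ℝ, 0 < ε → ε ≤ ε₀ →
      ConstantsWellDefined ω ε ∧ 0 < omegaTilde ω ε - υ ∧
      ∀ S₂ : ℝ → ℝ → X →L[ℝ] X, IsInvertibleEvolutionProcess S₂ →
        BddAbove (gapSet υ S₁ S₂) → sSup (gapSet υ S₁ S₂) < ε →
        IsWeakStarInvertibleProcess (dualFamily S₂) ∧
        BddAbove (growthSet υ S₂) ∧
        ∀ L : ℝ, (IsLUB (growthSet υ S₂) L ∨ IsLUB (growthSet υ (dualFamily S₂)) L) →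
          AdmitsNEDI (dualFamily S₂) (boundConst M ω ε L) (2 * υ) (omegaTilde ω ε - υ) ∧
          (Function.Surjective (NormedSpace.inclusionInDoubleDual ℝ X) →
            AdmitsNEDII S₂ (boundConst M ω ε L) (2 * υ) (omegaTilde ω ε - υ)) := by
  obtain ⟨P, hP, α, β, δ, ν, hM, -, -, -, -, hδν, hαβ, hs, hu⟩ := hNED
  have hω : 0 < ω := hυ.trans hυω
  have hM1 : 1 ≤ M := one_le_dichotomy_bound hS₁ hP hs hu
  have hgreen := norm_greenOp_le hM hs hu
  rw [hδν, hαβ] at hgreen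
  set D := contractionConst M υ ω with hD
  have hΩ := continuousAt_omegaTilde (ω := ω)
  have c1 : ContinuousAt (fun ε : ℝ => ε * (2 * M / (1 - Real.exp (-ω)))) 0 := by fun_prop
  have c2 : ContinuousAt (fun ε : ℝ => ε * D) 0 := by fun_prop
  -- At ε = 0 this function equals e^{2ω} > 1. Staying above 1 is what gives M/(1 - εD) ≤ M e^{2ω̃}.
  have c3 : ContinuousAt (fun ε : ℝ => Real.exp (2 * omegaTilde ω ε) * (1 - ε * D)) 0 := by
    fun_prop
  have hev := (eventually_constantsWellDefined hω).and
    ((hΩ.eventually_const_lt (by rwa [omegaTilde_zero hω] : υ < omegaTilde ω 0)).and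
    ((c1.eventually_lt_const (by simp : _ < (1 : ℝ))).and
    ((c2.eventually_lt_const (by simp : _ < (1 : ℝ))).and
    (c3.eventually_const_lt (by simpa [omegaTilde_zero hω] using hω : (1 : ℝ) < _)))))
  obtain ⟨r, hr, hball⟩ := Metric.eventually_nhds_iff.1 hev
  refine ⟨r / 2, by positivity, fun ε hε hεr => ?_⟩
  obtain ⟨hwd, hυΩ, h1, h2, h3⟩ := hball (y := ε) (by
    rw [Real.dist_eq, sub_zero, abs_of_pos hε]; linarith)
  refine ⟨hwd, sub_pos.2 hυΩ, fun S₂ hS₂ hb hlt => ?_⟩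
  have hgap := norm_sub_le_of_sSup_gapSet_lt hb hlt
  have h : IsPerturbedDichotomy S₁ S₂ P M υ ω ε :=
    ⟨hS₁, hS₂, hP, hυ, hυω, hM.le, hε.le, hgreen, hgap⟩
  refine ⟨hS₂.dual_isWeakStarInvertibleProcess,
    bddAbove_growthSet_of_gap hυ hε.le hL hgap, fun L hLub => ?_⟩
  have hL1 : 1 ≤ L := hLub.elim (one_le_of_isLUB_growthSet hS₂.refl)
    (one_le_of_isLUB_growthSet hS₂.dual_isWeakStarInvertibleProcess.refl)
  obtain ⟨P₂, hP₂, hs₂, hu₂⟩ := h.exists_splitting h1 h2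
  set K := boundConst M ω ε L with hK
  have hKle : M * Real.exp (2 * omegaTilde ω ε) ≤ K := le_boundConst hM1 hω hε.le hL1 hwd
  have hK0 : 0 < K := (by positivity : 0 < M * Real.exp (2 * omegaTilde ω ε)).trans_le hKle
  have hNK : M / (1 - ε * D) ≤ K := by
    refine le_trans ?_ hKle
    rw [div_le_iff₀ (by linarith), mul_assoc]
    exact le_mul_of_one_le_right hM.le h3.le
  have hΩω : omegaTilde ω ε - υ ≤ ω - υ := sub_le_sub_right (omegaTilde_le hω hε.le) υ
  have weaken : ∀ t d : ℝ, 0 ≤ d → M / (1 - ε * D) *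
      (Real.exp (υ * |t|) * Real.exp (-(ω - υ) * d)) ≤
      K * Real.exp (2 * υ * |t|) * Real.exp (-(omegaTilde ω ε - υ) * d) := fun t d hd => by
    rw [mul_assoc]
    gcongr
    linarith
  have hs₃ : ∀ t s, s ≤ t → ‖(S₂ t s).comp (ContinuousLinearMap.id ℝ X - P₂ s)‖ ≤
      K * Real.exp (2 * υ * |t|) * Real.exp (-(omegaTilde ω ε - υ) * (t - s)) := fun t s hst =>
    (hs₂ t s hst).trans (weaken t (t - s) (sub_nonneg.2 hst))
  -- The diagonal is included because the stable estimate of the dual family, which comes from this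
  -- one, includes it.
  have hu₃ : ∀ t s, t ≤ s → ‖(S₂ t s).comp (P₂ s)‖ ≤
      K * Real.exp (2 * υ * |t|) * Real.exp ((omegaTilde ω ε - υ) * (t - s)) := fun t s hst => by
    have e : ∀ c : ℝ, c * (t - s) = -c * (s - t) := fun c => by ring
    have := hu₂ t s hst
    rw [e] at this ⊢
    exact this.trans (weaken t (s - t) (sub_nonneg.2 hst))
  have hυ0 : 0 ≤ 2 * υ := by positivity
  refine ⟨⟨_, hP₂.dual hS₂, omegaTilde ω ε - υ, omegaTilde ω ε - υ, 2 * υ, 2 * υ, hK0,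
    sub_pos.2 hυΩ, sub_pos.2 hυΩ, hυ0, hυ0, max_self _, min_self _, fun t s hst => ?_,
    fun t s hst => ?_⟩, fun _ => ⟨P₂, hP₂, omegaTilde ω ε - υ, omegaTilde ω ε - υ, 2 * υ, 2 * υ,
    hK0, sub_pos.2 hυΩ, sub_pos.2 hυΩ, hυ0, hυ0, max_self _, min_self _, hs₃,
    fun t s hst => hu₃ t s hst.le⟩⟩
  -- The stable part of T₂(t,s) is the adjoint of the unstable part of S₂(s,t), whose final time is
  -- s; so the nonuniformity now sits at the initial time.
  · have e : (dualFamily S₂ t s).comp (ContinuousLinearMap.id ℝ (StrongDual ℝ X) -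
        ContinuousLinearMap.precomp ℝ (ContinuousLinearMap.id ℝ X - P₂ s)) =
        ContinuousLinearMap.precomp ℝ ((S₂ s t).comp (P₂ t)) := by
      ext φ x
      simp [dualFamily, hP₂.comm_apply hS₂]
    rw [e]
    refine (norm_precomp_le _).trans ((hu₃ s t hst).trans (le_of_eq ?_))
    congr 2; ring
  · have e : (dualFamily S₂ t s).comp
        (ContinuousLinearMap.precomp ℝ (ContinuousLinearMap.id ℝ X - P₂ s)) =
        ContinuousLinearMap.precomp ℝ
          ((S₂ s t).comp (ContinuousLinearMap.id ℝ X - P₂ t)) := by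
      ext φ x
      simp [dualFamily, hP₂.comm_apply hS₂]
    rw [e]
    refine (norm_precomp_le _).trans ((hs₃ s t hst.le).trans (le_of_eq ?_))
    congr 2; ring
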